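/- **Theorem.** Let $I=(a,b)\subseteq\mathbb R$ be an interval, $-\infty\le a<b\le+\infty$, let $0<p,q\le+\infty$, and let $\mu,\nu$ be non-negative Borel measures on $I$. For $E\subseteq I$ Borel and $f\ge 0$ Borel write $\|f\|_{p,E,\mu}=\left(\int_E f^p\,d\mu\right)^{1/p}$ if $p<\infty$, and let $\|f\|_{\infty,E,\mu}$ be the $\mu$-essential supremum of $f$ over $E$ (equal to $0$ if $\mu(E)=0$); likewise for $\nu$. Conventions: $1/\infty=0$, $0\cdot\infty=0$, $0/0=0$, and $t/0=\infty$ for $t>0$. Let $u,w$ be non-negative Borel measurable functions on $I$ such that $\|u\|_{q,(a,t],\nu}<\infty$ for all $t\in I$ and $u\ne0$ $\nu$-a.e. on $I$. Consider the inequality $$\|gw\|_{p,(a,b),\mu}\le c\,\big\|u(x)\,\|g\|_{\infty,(x,b),\mu}\big\|_{q,(a,b),\nu}\qquad(*)$$ and let $c_*$ be the infimum of all finite $c\ge0$ such that $(*)$ holds for all non-negative Borel measurable $g$ on $I$ ($c_*=\infty$ if there is none). Below, $X\approx Y$ means $X\le CY$ and $Y\le CX$ with a finite constant $C>0$ depending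 only on $p$ and $q$. (i) Let $q\le p\le\infty$. Then $(*)$ holds for all $g$ with some finite $c$ if and only if $$A_1=\Big\|\,\|w\|_{p,(a,x],\mu}\,\|u\|_{q,(a,x),\nu}^{-1}\Big\|_{\infty,(a,b),\mu}<\infty,$$ and $c_*\approx A_1$. (ii) Let $p<q<\infty$ and $1/r=1/p-1/q$. Then $(*)$ holds for all $g$ with some finite $c$ if and only if $$A_2=\left(\int_{(a,b)}\|w\|_{p,(a,x],\mu}^{r}\,d\left(-\|u\|_{q,(a,x],\nu}^{-r}\right)\right)^{1/r}+\|w\|_{p,(a,b),\mu}\,\|u\|_{q,(a,b),\nu}^{-1}<\infty,$$ and $c_*\approx A_2$. (iii) Let $p<\infty$ and $q=\infty$. Then $(*)$ holds for all $g$ with some finite $c$ if and only if $$A_3=\left(\int_{(a,b)}\left(\frac{w(x)}{\|u\|_{\infty,(a,x),\nu}}\right)^p d\mu(x)\right)^{1/p}<\infty,$$ and $c_*\approx A_3$. Moreover, with $\|u\|_{\infty,(a,x+],\nu}=\lim_{s\to x+}\|u\|_{\infty,(a,s],\nu}$, $$A_3\approx\left(\int_{(a,b)}\|w\|_{p,(a,x],\mu}^{p}\,d\left(-\|u\|_{\infty,(a,x+],\nu}^{-p}\right)\right)^{1/p}+\|w\|_{p,(a,b),\mu}\,\|u\|_{\infty,(a,b),\nu}^{-1}.$$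 Here, for $f:I\to[0,\infty]$ and $h:I\to[-\infty,0]$ non-decreasing and right-continuous, $\int_{(a,b)}f\,dh$ is the Lebesgue–Stieltjes integral if $h$ is finite on $I$. If $h=-\infty$ somewhere in $I$, let $c=\sup\{x\in I:h(x)=-\infty\}$; the integral is defined only if $f=0$ on $(a,c]\cap I$, and then $\int_{(a,b)}f\,dh=\int_{(c,b)}f\,dh$. If the integral is not defined, it is given the value $\infty$ (the condition fails). -/

import Mathlib

open MeasureTheory Set
open scoped ENNReal NNReal

noncomputable section

namespace SupremalHardy

/-- The interval `(a, b) ⊆ ℝ` with endpoints in `[-∞, ∞]`. -/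
def rIoo (a b : EReal) : Set ℝ := {x | a < (x : EReal) ∧ (x : EReal) < b}

/-- The interval `(a, b] ⊆ ℝ` with endpoints in `[-∞, ∞]`. -/
def rIoc (a b : EReal) : Set ℝ := {x | a < (x : EReal) ∧ (x : EReal) ≤ b}

/-- `‖f‖_{p,E,μ}`: it is `(∫_E f ^ p dμ) ^ (1 / p)` for `0 < p < ∞`, and the `μ`-essential
supremum of `f` over `E` for `p = ∞` (which is `0` if `μ E = 0`). -/
def qnorm (f : ℝ → ℝ≥0∞) (p : ℝ≥0∞) (E : Set ℝ) (μ : Measure ℝ) : ℝ≥0∞ :=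
  eLpNorm f p (μ.restrict E)

/-- The inequality `‖g w‖_{p,(a,b),μ} ≤ c ‖u(x) ‖g‖_{∞,(x,b),μ}‖_{q,(a,b),ν}` for all non-negative
Borel functions `g`. (Products in `ℝ≥0∞` obey `0 * ∞ = 0`; by monotone convergence it makes
no difference whether `g` may take the value `∞`.) -/
def ReverseHardy (p q : ℝ≥0∞) (a b : EReal) (μ ν : Measure ℝ) (u w : ℝ → ℝ≥0∞) (c : ℝ≥0) : Prop :=
  ∀ g : ℝ → ℝ≥0∞, Measurable g →
    qnorm (fun x => g x * w x) p (rIoo a b) μ ≤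
      (c : ℝ≥0∞) * qnorm (fun x => u x * qnorm g ∞ (rIoo x b) μ) q (rIoo a b) ν

/-- The best possible constant (`∞` if there is no finite admissible constant). -/
def bestConst (p q : ℝ≥0∞) (a b : EReal) (μ ν : Measure ℝ) (u w : ℝ → ℝ≥0∞) : ℝ≥0∞ :=
  ⨅ (c : ℝ≥0) (_ : ReverseHardy p q a b μ ν u w c), (c : ℝ≥0∞)

/-- The function that agrees with `h` on `[α, β]` and is constant on both sides of it. -/
def clampFun (h : ℝ → EReal) (α β : ℝ) : ℝ → ℝ := fun x => (h (max α (min x β))).toReal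

theorem clampFun_monotone {h : ℝ → EReal} {α β : ℝ} (hαβ : α ≤ β)
    (hm : MonotoneOn h (Icc α β)) (hb : h α ≠ ⊥) (ht : h β ≠ ⊤) :
    Monotone (clampFun h α β) := by
  have hmem : ∀ x : ℝ, max α (min x β) ∈ Icc α β := fun x =>
    ⟨le_max_left _ _, max_le hαβ (min_le_right _ _)⟩
  intro x y hxy
  refine EReal.toReal_le_toReal (hm (hmem x) (hmem y) (by gcongr)) ?_ ?_
  · exact ne_of_gt (lt_of_lt_of_le (bot_lt_iff_ne_bot.2 hb)
      (hm ⟨le_rfl, hαβ⟩ (hmem x) (hmem x).1))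
  · exact ne_of_lt (lt_of_le_of_lt (hm (hmem y) ⟨hαβ, le_rfl⟩ (hmem y).2)
      (lt_top_iff_ne_top.2 ht))

open Classical in
/-- The Lebesgue-Stieltjes measure of `clampFun h α β`. On `(α, β)` it is the Lebesgue-Stieltjes
measure `dh` when `h` is non-decreasing and finite on `[α, β]`. -/
def lsMeasure (h : ℝ → EReal) (α β : ℝ) : Measure ℝ :=
  if hm : Monotone (clampFun h α β) then hm.stieltjesFunction.measure else 0

/-- The Lebesgue-Stieltjes integral `∫_{(a,b)} f dh` of `f ≥ 0` with respect to a function `h`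
that is non-decreasing and finite on `(a, b)`: the supremum over compact subintervals `[α, β]`
of the integrals over `(α, β)`. -/
def lsIntegralFin (a b : EReal) (f : ℝ → ℝ≥0∞) (h : ℝ → EReal) : ℝ≥0∞ :=
  ⨆ (α : ℝ) (β : ℝ) (_ : a < (α : EReal)) (_ : α < β) (_ : (β : EReal) < b),
    ∫⁻ x in Ioo α β, f x ∂(lsMeasure h α β)

/-- The right end of the (possibly empty) interval `{x ∈ (a, b) | h x = -∞}`, for `h`
non-decreasing on `(a, b)`; it is `a` if `h` is finite on `(a, b)`. -/
def botEnd (a b : EReal) (h : ℝ → EReal) : EReal :=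
  a ⊔ sSup ((fun x : ℝ => (x : EReal)) '' {x | x ∈ rIoo a b ∧ h x = ⊥})

open Classical in
/-- `∫_{(a,b)} f dh` for `f : (a, b) → [0, ∞]` and `h : (a, b) → [-∞, 0]` non-decreasing. If
`h = -∞` on the left of `c`, the integral is defined only if `f = 0` on `(a, c]`, and is then
the integral over `(c, b)`. An undefined integral gets the value `∞`, so that a condition
`∫ f dh < ∞` says that the integral is defined and finite. -/
def lsIntegral (a b : EReal) (f : ℝ → ℝ≥0∞) (h : ℝ → EReal) : ℝ≥0∞ :=
  if ∀ x ∈ rIoo a b, (x : EReal) ≤ botEnd a b h → f x = 0 then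
    lsIntegralFin (botEnd a b h) b f h
  else ∞

/-- `‖ ‖w‖_{p,(a,x],μ} / ‖u‖_{q,(a,x),ν} ‖_{∞,(a,b),μ}`
(in `ℝ≥0∞`, `0 / 0 = 0` and `t / 0 = ∞` for `t > 0`). -/
def A₁ (p q : ℝ≥0∞) (a b : EReal) (μ ν : Measure ℝ) (u w : ℝ → ℝ≥0∞) : ℝ≥0∞ :=
  qnorm (fun x => qnorm w p (rIoc a x) μ * (qnorm u q (rIoo a x) ν)⁻¹) ∞ (rIoo a b) μ

/-- `(∫_{(a,b)} ‖w‖_{p,(a,x],μ}^r d(-‖u‖_{q,(a,x],ν}^{-r}))^{1/r}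
  + ‖w‖_{p,(a,b),μ} ‖u‖_{q,(a,b),ν}^{-1}`. -/
def A₂ (p q : ℝ≥0∞) (r : ℝ) (a b : EReal) (μ ν : Measure ℝ) (u w : ℝ → ℝ≥0∞) : ℝ≥0∞ :=
  (lsIntegral a b (fun x => qnorm w p (rIoc a x) μ ^ r)
      (fun x => -((qnorm u q (rIoc a x) ν ^ (-r) : ℝ≥0∞) : EReal))) ^ (1 / r)
    + qnorm w p (rIoo a b) μ * (qnorm u q (rIoo a b) ν)⁻¹

/-- `(∫_{(a,b)} (w(x) / ‖u‖_{∞,(a,x),ν})^p dμ(x))^{1/p}`. -/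
def A₃ (p : ℝ) (a b : EReal) (μ ν : Measure ℝ) (u w : ℝ → ℝ≥0∞) : ℝ≥0∞ :=
  (∫⁻ x in rIoo a b, (w x / qnorm u ∞ (rIoo a x) ν) ^ p ∂μ) ^ (1 / p)

/-- `‖u‖_{∞,(a,x+],ν} = lim_{s → x+} ‖u‖_{∞,(a,s],ν}`. -/
def supNormRight (a : EReal) (ν : Measure ℝ) (u : ℝ → ℝ≥0∞) : ℝ → ℝ≥0∞ :=
  Function.rightLim (fun s : ℝ => qnorm u ∞ (rIoc a s) ν)

/-- `(∫_{(a,b)} ‖w‖_{p,(a,x],μ}^p d(-‖u‖_{∞,(a,x+],ν}^{-p}))^{1/p}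
  + ‖w‖_{p,(a,b),μ} ‖u‖_{∞,(a,b),ν}^{-1}`. -/
def A₃' (p : ℝ≥0∞) (a b : EReal) (μ ν : Measure ℝ) (u w : ℝ → ℝ≥0∞) : ℝ≥0∞ :=
  (lsIntegral a b (fun x => qnorm w p (rIoc a x) μ ^ p.toReal)
      (fun x => -((supNormRight a ν u x ^ (-p.toReal) : ℝ≥0∞) : EReal))) ^ (1 / p.toReal)
    + qnorm w p (rIoo a b) μ * (qnorm u ∞ (rIoo a b) ν)⁻¹

/-- `A ≈ B` with a constant of equivalence `C`. -/
def EquivWith (C : ℝ≥0) (A B : ℝ≥0∞) : Prop := A ≤ C * B ∧ B ≤ C * A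

end SupremalHardy

end

open SupremalHardy

/-!
The function `G x = ‖g‖_{∞,(x,b),μ}` is non-increasing, and `g ≤ G(x-)` holds `μ`-almost everywhere
(`ae_le_tailSupLeft`). So the inequality compares the integral of a monotone function against
`w ^ p μ` with that of the same function, up to its jumps, against `u ^ q ν`. Everything is decided
on initial segments of `(a, b)`: testing with the characteristic function of `(a, x]` shows that
`‖w‖_{p,(a,x],μ} ≤ c ‖u‖_{q,(a,x),ν}` is necessary (`qnorm_rIoc_le_of_reverseHardy`). All integrals
are replaced by dyadic sums over layers `{f > 2 ^ k}`, in which geometric weights allow one to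
exchange a sum for its largest term (`tsum_indicator_two_rpow_le`).

For `q ≤ p` the necessary condition is sufficient, because `ℓ¹ ⊆ ℓ^{p/q}` lets the layers of `G` be
summed.

For `p < q < ∞` the intermediate quantity is `D = ∑ 2 ^ (-j r) ‖w‖_{p,S j,μ} ^ r` with the initial
segments `S j = {x | ‖u‖_{q,(a,x),ν} < 2 ^ j}`. The inequality with constant comparable to
`D ^ (1 / r)` follows from the Hölder inequality over the levels (`reverseHardy_of_levelSum`), and
the extremal sequence for it, turned into a staircase test function, gives the converse by a
discrete Hardy inequality (`levelSum_le_of_reverseHardy`). That `D` is equivalent to the Stieltjes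
integral in `A₂` together with its boundary term (`exists_levelSum_equiv`) holds for any two
monotone functions `V`, `W` in place of the norms: layering `W` turns both quantities into
`∑ 2 ^ (k r) sup {V(x-) ^ (-r) : W x > 2 ^ k}`, since the Stieltjes measure of a final segment is
`V ^ (-r)` at its left end, minus the value at `b`.

For `q = ∞` the best constant is exactly `A₃`, by the test function `1 / ‖u‖_{∞,(a,x),ν}`. The
quantity `A₃ ^ p` is comparable to `D` with `r = p` by integrating a geometric series, and the
general equivalence then gives the Stieltjes form.
-/

namespace SupremalHardy

/-! ### Dyadic sums -/

theorem two_rpow_ne_zero (x : ℝ) : (2 : ℝ≥0∞) ^ x ≠ 0 :=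
  (ENNReal.rpow_pos (by norm_num) (by norm_num)).ne'

theorem two_rpow_ne_top (x : ℝ) : (2 : ℝ≥0∞) ^ x ≠ ∞ :=
  ENNReal.rpow_ne_top_of_ne_zero (by norm_num) (by norm_num)

theorem two_rpow_add (x y : ℝ) : (2 : ℝ≥0∞) ^ (x + y) = 2 ^ x * 2 ^ y :=
  ENNReal.rpow_add _ _ (by norm_num) (by norm_num)

theorem two_rpow_le {x y : ℝ} (h : x ≤ y) : (2 : ℝ≥0∞) ^ x ≤ 2 ^ y :=
  ENNReal.rpow_le_rpow_of_exponent_le (by norm_num) h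

/-- The geometric series `∑ 2 ^ (-n s)`. -/
noncomputable def geomConst (s : ℝ) : ℝ≥0∞ := ∑' n : ℕ, (2 : ℝ≥0∞) ^ (-(n * s))

theorem geomConst_ne_top {s : ℝ} (hs : 0 < s) : geomConst s ≠ ∞ := by
  have h : ∀ n : ℕ, (2 : ℝ≥0∞) ^ (-((n : ℝ) * s)) = ((2 : ℝ≥0∞) ^ (-s)) ^ n := by
    intro n
    rw [← ENNReal.rpow_natCast, ← ENNReal.rpow_mul]
    congr 1
    ring
  have hlt : (2 : ℝ≥0∞) ^ (-s) < 1 :=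
    ENNReal.rpow_lt_one_of_one_lt_of_neg (by norm_num) (by linarith)
  simp only [geomConst, h, ENNReal.tsum_geometric]
  exact ENNReal.inv_ne_top.2 (tsub_pos_of_lt hlt).ne'

theorem one_le_geomConst (s : ℝ) : 1 ≤ geomConst s := by
  refine le_trans ?_ (ENNReal.le_tsum 0)
  simp

/-- The case of increasing weights: either `M = ∞`, or the index set has a largest element, below
which the sum is a geometric series. -/
theorem tsum_indicator_le_of_pos {s : ℝ} (hs : 0 < s) (J : Set ℤ) (M : ℝ≥0∞)
    (h : ∀ j ∈ J, (2 : ℝ≥0∞) ^ ((j : ℝ) * s) ≤ M) :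
    ∑' j : ℤ, J.indicator (fun j => (2 : ℝ≥0∞) ^ ((j : ℝ) * s)) j ≤ geomConst s * M := by
  rcases J.eq_empty_or_nonempty with rfl | hne
  · simp
  rcases eq_or_ne M ∞ with rfl | hM
  · rw [ENNReal.mul_top (zero_lt_one.trans_le (one_le_geomConst s)).ne']
    exact le_top
  have hbdd : BddAbove J := by
    obtain ⟨N, hN⟩ := exists_nat_gt (Real.logb 2 M.toReal / s)
    refine ⟨N, fun j hj => ?_⟩
    by_contra! hlt
    have h1 := ENNReal.toReal_mono hM (h j hj)
    rw [← ENNReal.toReal_rpow, ENNReal.toReal_ofNat] at h1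
    have h2 : (0 : ℝ) < 2 ^ ((j : ℝ) * s) := by positivity
    have h3 := Real.logb_le_logb_of_le (b := 2) (by norm_num) h2 h1
    rw [Real.logb_rpow (by norm_num) (by norm_num), ← le_div_iff₀ hs] at h3
    have h4 : (N : ℝ) < j := by exact_mod_cast hlt
    linarith
  obtain ⟨j₀, hj₀, hmax⟩ := Int.exists_greatest_of_bdd (P := fun j => j ∈ J)
    (by obtain ⟨B, hB⟩ := hbdd; exact ⟨B, fun z hz => hB hz⟩) hne
  have hinj : Function.Injective (fun n : ℕ => j₀ - (n : ℤ)) := by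
    intro m n hmn
    simp only at hmn
    omega
  calc ∑' j : ℤ, J.indicator (fun j => (2 : ℝ≥0∞) ^ ((j : ℝ) * s)) j
      ≤ ∑' j : ℤ, (Iic j₀).indicator (fun j => (2 : ℝ≥0∞) ^ ((j : ℝ) * s)) j :=
        ENNReal.tsum_le_tsum fun j =>
          indicator_le_indicator_of_subset (fun j hj => hmax j hj) (fun _ => zero_le) j
    _ = ∑' n : ℕ, (2 : ℝ≥0∞) ^ (((j₀ - (n : ℤ) : ℤ) : ℝ) * s) := by
        rw [← hinj.tsum_eq]
        · refine tsum_congr fun n => ?_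
          rw [indicator_of_mem]
          simp
        · intro j hj
          have : j ≤ j₀ := by
            by_contra hcon
            exact hj (indicator_of_notMem (s := Iic j₀) hcon _)
          exact ⟨(j₀ - j).toNat, by simp only; omega⟩
    _ = geomConst s * 2 ^ ((j₀ : ℝ) * s) := by
        rw [geomConst, ← ENNReal.tsum_mul_right]
        refine tsum_congr fun n => ?_
        rw [← two_rpow_add]
        congr 1
        push_cast
        ring
    _ ≤ geomConst s * M := by gcongr; exact h j₀ hj₀

/-- A geometric sum over any set of integers is comparable to its largest term. -/
theorem tsum_indicator_two_rpow_le {s : ℝ} (hs : s ≠ 0) (J : Set ℤ) (M : ℝ≥0∞)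
    (h : ∀ j ∈ J, (2 : ℝ≥0∞) ^ ((j : ℝ) * s) ≤ M) :
    ∑' j : ℤ, J.indicator (fun j => (2 : ℝ≥0∞) ^ ((j : ℝ) * s)) j ≤ geomConst |s| * M := by
  rcases lt_or_gt_of_ne hs with hneg | hpos
  · rw [abs_of_neg hneg]
    have := tsum_indicator_le_of_pos (neg_pos.2 hneg) (Neg.neg ⁻¹' J) M (fun j hj => by
      have := h _ hj
      push_cast at this
      rwa [neg_mul, ← mul_neg] at this)
    refine le_trans (le_of_eq ?_) this
    rw [← (Equiv.neg ℤ).tsum_eq]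
    refine tsum_congr fun j => ?_
    by_cases hj : -j ∈ J
    · simp [indicator_of_mem, hj]
    · simp [indicator_of_notMem, hj]
  · rw [abs_of_pos hpos]
    exact tsum_indicator_le_of_pos hpos J M h

theorem exists_two_rpow_lt_le {x : ℝ≥0∞} (h0 : x ≠ 0) (ht : x ≠ ∞) :
    ∃ k : ℤ, (2 : ℝ≥0∞) ^ (k : ℝ) < x ∧ x ≤ 2 ^ ((k : ℝ) + 1) := by
  obtain ⟨k, hk⟩ := ENNReal.exists_mem_Ioc_zpow (x := x) (y := 2) h0 ht (by norm_num) (by norm_num)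
  refine ⟨k, ?_, ?_⟩
  · rw [ENNReal.rpow_intCast]; exact hk.1
  · have := hk.2
    rw [← ENNReal.rpow_intCast] at this
    push_cast at this
    exact this

theorem exists_two_rpow_le_lt {x : ℝ≥0∞} (h0 : x ≠ 0) (ht : x ≠ ∞) :
    ∃ k : ℤ, (2 : ℝ≥0∞) ^ (k : ℝ) ≤ x ∧ x < 2 ^ ((k : ℝ) + 1) := by
  obtain ⟨k, hk⟩ := ENNReal.exists_mem_Ico_zpow (x := x) (y := 2) h0 ht (by norm_num) (by norm_num)
  refine ⟨k, ?_, ?_⟩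
  · rw [ENNReal.rpow_intCast]; exact hk.1
  · have := hk.2
    rw [← ENNReal.rpow_intCast] at this
    push_cast at this
    exact this

theorem exists_lt_two_rpow {s : ℝ} (hs : 0 < s) {M : ℝ≥0∞} (hM : M ≠ ∞) :
    ∃ k : ℤ, M < (2 : ℝ≥0∞) ^ ((k : ℝ) * s) := by
  by_contra! hcon
  have h1 : ∀ j : ℤ, (2 : ℝ≥0∞) ^ ((j : ℝ) * s) ≤ M := hcon
  have h2 := tsum_indicator_le_of_pos hs univ M (fun j _ => h1 j)
  simp only [indicator_univ] at h2
  have h3 : ∑' j : ℤ, (2 : ℝ≥0∞) ^ ((j : ℝ) * s) = ∞ := by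
    refine top_unique ?_
    calc (∞ : ℝ≥0∞) = ∑' n : ℕ, (1 : ℝ≥0∞) := by simp
      _ ≤ ∑' n : ℕ, (2 : ℝ≥0∞) ^ (((n : ℤ) : ℝ) * s) :=
          ENNReal.tsum_le_tsum fun n => by
            have : (2 : ℝ≥0∞) ^ (0 : ℝ) ≤ 2 ^ (((n : ℤ) : ℝ) * s) :=
              two_rpow_le (by push_cast; positivity)
            simpa using this
      _ ≤ ∑' j : ℤ, (2 : ℝ≥0∞) ^ ((j : ℝ) * s) :=
          ENNReal.tsum_comp_le_tsum_of_injective Nat.cast_injective _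
  rw [h3, top_le_iff] at h2
  exact ENNReal.mul_ne_top (geomConst_ne_top hs) hM h2

/-- The dyadic layers of `x` sum up to at most a multiple of `x ^ s`; see `rpow_le_tsum_layer` for
the converse. -/
theorem tsum_layer_le {s : ℝ} (hs : 0 < s) (x : ℝ≥0∞) :
    ∑' k : ℤ, {k : ℤ | (2 : ℝ≥0∞) ^ (k : ℝ) < x}.indicator (fun k => (2 : ℝ≥0∞) ^ ((k : ℝ) * s)) k ≤
      geomConst s * x ^ s := by
  refine tsum_indicator_le_of_pos hs _ _ fun j hj => ?_
  rw [ENNReal.rpow_mul]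
  exact ENNReal.rpow_le_rpow (le_of_lt hj) hs.le

theorem rpow_le_tsum_layer {s : ℝ} (hs : 0 < s) (x : ℝ≥0∞) :
    x ^ s ≤ 2 ^ s *
      ∑' k : ℤ, {k : ℤ | (2 : ℝ≥0∞) ^ (k : ℝ) < x}.indicator
        (fun k => (2 : ℝ≥0∞) ^ ((k : ℝ) * s)) k := by
  rcases eq_or_ne x 0 with rfl | h0
  · simp [hs]
  rcases eq_or_ne x ∞ with rfl | ht
  · refine le_of_le_of_eq le_top (Eq.symm ?_)
    refine ENNReal.mul_eq_top.2 (Or.inl ⟨two_rpow_ne_zero s, ?_⟩)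
    by_contra hne
    obtain ⟨k, hk⟩ := exists_lt_two_rpow hs hne
    refine (lt_of_lt_of_le hk ?_).false
    refine le_trans (le_of_eq ?_) (ENNReal.le_tsum k)
    rw [indicator_of_mem]
    exact (two_rpow_ne_top _).lt_top
  · obtain ⟨k, hk1, hk2⟩ := exists_two_rpow_lt_le h0 ht
    calc x ^ s ≤ (2 ^ ((k : ℝ) + 1)) ^ s := ENNReal.rpow_le_rpow hk2 hs.le
      _ = 2 ^ s * 2 ^ ((k : ℝ) * s) := by
          rw [← ENNReal.rpow_mul, ← two_rpow_add]; congr 1; ring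
      _ ≤ _ := by
          gcongr
          refine le_trans (le_of_eq ?_) (ENNReal.le_tsum k)
          rw [indicator_of_mem]
          exact hk1

/-- The dyadic layer-cake sum `∑ 2 ^ (k s) λ {f > 2 ^ k}`. -/
theorem lintegral_tsum_layer {X : Type*} [MeasurableSpace X] (lam : Measure X) {f : X → ℝ≥0∞}
    (hf : Measurable f) (s : ℝ) :
    ∫⁻ x, ∑' k : ℤ, {k : ℤ | (2 : ℝ≥0∞) ^ (k : ℝ) < f x}.indicator
        (fun k => (2 : ℝ≥0∞) ^ ((k : ℝ) * s)) k ∂lam =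
      ∑' k : ℤ, 2 ^ ((k : ℝ) * s) * lam {x | (2 : ℝ≥0∞) ^ (k : ℝ) < f x} := by
  have hm : ∀ k : ℤ, MeasurableSet {x | (2 : ℝ≥0∞) ^ (k : ℝ) < f x} := fun k =>
    measurableSet_lt measurable_const hf
  have he : ∀ (k : ℤ) (x : X), {k : ℤ | (2 : ℝ≥0∞) ^ (k : ℝ) < f x}.indicator
        (fun k => (2 : ℝ≥0∞) ^ ((k : ℝ) * s)) k =
      {x | (2 : ℝ≥0∞) ^ (k : ℝ) < f x}.indicator (fun _ => (2 : ℝ≥0∞) ^ ((k : ℝ) * s)) x := by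
    intro k x
    by_cases h : (2 : ℝ≥0∞) ^ (k : ℝ) < f x <;>
      simp only [indicator, mem_ofPred_eq, h, if_true, if_false]
  simp only [he]
  rw [lintegral_tsum fun k => (measurable_const.indicator (hm k)).aemeasurable]
  refine tsum_congr fun k => ?_
  rw [lintegral_indicator (hm k), lintegral_const, Measure.restrict_apply_univ]

theorem lintegral_rpow_le_layer {X : Type*} [MeasurableSpace X] (lam : Measure X) {f : X → ℝ≥0∞}
    (hf : Measurable f) {s : ℝ} (hs : 0 < s) :
    ∫⁻ x, f x ^ s ∂lam ≤
      2 ^ s * ∑' k : ℤ, 2 ^ ((k : ℝ) * s) * lam {x | (2 : ℝ≥0∞) ^ (k : ℝ) < f x} := by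
  rw [← lintegral_tsum_layer lam hf s, ← lintegral_const_mul' _ _ (two_rpow_ne_top s)]
  exact lintegral_mono fun x => rpow_le_tsum_layer hs (f x)

theorem layer_le_lintegral_rpow {X : Type*} [MeasurableSpace X] (lam : Measure X) {f : X → ℝ≥0∞}
    (hf : Measurable f) {s : ℝ} (hs : 0 < s) :
    ∑' k : ℤ, 2 ^ ((k : ℝ) * s) * lam {x | (2 : ℝ≥0∞) ^ (k : ℝ) < f x} ≤
      geomConst s * ∫⁻ x, f x ^ s ∂lam := by
  rw [← lintegral_tsum_layer lam hf s, ← lintegral_const_mul' _ _ (geomConst_ne_top hs)]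
  exact lintegral_mono fun x => tsum_layer_le hs (f x)

/-- Layer-cake bound for a sum over `ℤ` with geometric weights `2 ^ (j t)`: the weight of
`{j | 2 ^ k < f j}` is comparable to that of a single index. -/
theorem tsum_rpow_le_layer {s t : ℝ} (hs : 0 < s) (ht : t ≠ 0) (f : ℤ → ℝ≥0∞) (m : ℤ → ℝ≥0∞)
    (h : ∀ k j : ℤ, (2 : ℝ≥0∞) ^ (k : ℝ) < f j → (2 : ℝ≥0∞) ^ ((j : ℝ) * t) ≤ m k) :
    ∑' j : ℤ, 2 ^ ((j : ℝ) * t) * f j ^ s ≤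
      2 ^ s * geomConst |t| * ∑' k : ℤ, 2 ^ ((k : ℝ) * s) * m k := by
  calc ∑' j : ℤ, 2 ^ ((j : ℝ) * t) * f j ^ s
      ≤ ∑' j : ℤ, 2 ^ ((j : ℝ) * t) * (2 ^ s *
          ∑' k : ℤ, {k : ℤ | (2 : ℝ≥0∞) ^ (k : ℝ) < f j}.indicator
            (fun k => (2 : ℝ≥0∞) ^ ((k : ℝ) * s)) k) := by
        gcongr with j
        exact rpow_le_tsum_layer hs _
    _ = 2 ^ s * ∑' j : ℤ, ∑' k : ℤ, 2 ^ ((k : ℝ) * s) *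
          {j : ℤ | (2 : ℝ≥0∞) ^ (k : ℝ) < f j}.indicator
            (fun j => (2 : ℝ≥0∞) ^ ((j : ℝ) * t)) j := by
        rw [← ENNReal.tsum_mul_left]
        refine tsum_congr fun j => ?_
        rw [mul_left_comm, ← ENNReal.tsum_mul_left]
        congr 1
        refine tsum_congr fun k => ?_
        by_cases hk : (2 : ℝ≥0∞) ^ (k : ℝ) < f j <;>
          simp only [indicator, mem_ofPred_eq, hk, if_true, if_false, zero_mul, mul_comm]
    _ = 2 ^ s * ∑' k : ℤ, 2 ^ ((k : ℝ) * s) * ∑' j : ℤ,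
          {j : ℤ | (2 : ℝ≥0∞) ^ (k : ℝ) < f j}.indicator
            (fun j => (2 : ℝ≥0∞) ^ ((j : ℝ) * t)) j := by
        rw [ENNReal.tsum_comm]
        simp only [ENNReal.tsum_mul_left]
    _ ≤ 2 ^ s * ∑' k : ℤ, 2 ^ ((k : ℝ) * s) * (geomConst |t| * m k) := by
        gcongr with k
        exact tsum_indicator_two_rpow_le ht _ _ fun j hj => h k j hj
    _ = _ := by
        simp only [mul_left_comm _ (geomConst |t|), ENNReal.tsum_mul_left, mul_assoc]

/-- The converse of `tsum_rpow_le_layer`, without assumption on the weights. -/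
theorem layer_le_tsum_rpow {s t : ℝ} (hs : 0 < s) (f : ℤ → ℝ≥0∞) (m : ℤ → ℝ≥0∞)
    (h : ∀ k : ℤ, m k ≤ ∑' j : ℤ, {j : ℤ | (2 : ℝ≥0∞) ^ (k : ℝ) < f j}.indicator
            (fun j => (2 : ℝ≥0∞) ^ ((j : ℝ) * t)) j) :
    ∑' k : ℤ, 2 ^ ((k : ℝ) * s) * m k ≤ geomConst s * ∑' j : ℤ, 2 ^ ((j : ℝ) * t) * f j ^ s := by
  calc ∑' k : ℤ, 2 ^ ((k : ℝ) * s) * m k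
      ≤ ∑' k : ℤ, 2 ^ ((k : ℝ) * s) * ∑' j : ℤ, {j : ℤ | (2 : ℝ≥0∞) ^ (k : ℝ) < f j}.indicator
            (fun j => (2 : ℝ≥0∞) ^ ((j : ℝ) * t)) j := by
        gcongr with k
        exact h k
    _ = ∑' j : ℤ, 2 ^ ((j : ℝ) * t) * ∑' k : ℤ, {k : ℤ | (2 : ℝ≥0∞) ^ (k : ℝ) < f j}.indicator
            (fun k => (2 : ℝ≥0∞) ^ ((k : ℝ) * s)) k := by
        simp only [← ENNReal.tsum_mul_left]
        rw [ENNReal.tsum_comm]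
        refine tsum_congr fun j => tsum_congr fun k => ?_
        by_cases hk : (2 : ℝ≥0∞) ^ (k : ℝ) < f j <;>
          simp only [indicator, mem_ofPred_eq, hk, if_true, if_false, zero_mul, mul_comm]
    _ ≤ ∑' j : ℤ, 2 ^ ((j : ℝ) * t) * (geomConst s * f j ^ s) := by
        gcongr with j
        exact tsum_layer_le hs _
    _ = _ := by simp only [mul_left_comm _ (geomConst s), ENNReal.tsum_mul_left]

/-- The inclusion `ℓ¹ ⊆ ℓᵗ`. -/
theorem tsum_rpow_le_rpow_tsum {ι : Type*} (f : ι → ℝ≥0∞) {t : ℝ} (ht : 1 ≤ t) :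
    ∑' i, f i ^ t ≤ (∑' i, f i) ^ t := by
  have key : ∀ x : ℝ≥0∞, x ^ t = x * x ^ (t - 1) := fun x => by
    conv_lhs => rw [← add_sub_cancel 1 t, ENNReal.rpow_add_of_nonneg _ _ zero_le_one (by linarith),
      ENNReal.rpow_one]
  calc ∑' i, f i ^ t ≤ ∑' i, f i * (∑' i, f i) ^ (t - 1) := by
        refine ENNReal.tsum_le_tsum fun i => ?_
        rw [key]
        have h0 : 0 ≤ t - 1 := by linarith
        gcongr
        exact ENNReal.le_tsum i
    _ = (∑' i, f i) ^ t := by rw [ENNReal.tsum_mul_right, ← key]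

theorem tsum_mul_le_Lp_mul_Lq {ι : Type*} (f g : ι → ℝ≥0∞) {s t : ℝ} (hst : s.HolderConjugate t) :
    ∑' i, f i * g i ≤ (∑' i, f i ^ s) ^ (1 / s) * (∑' i, g i ^ t) ^ (1 / t) := by
  rw [ENNReal.tsum_eq_iSup_sum]
  refine iSup_le fun F => (ENNReal.inner_le_Lp_mul_Lq F f g hst).trans ?_
  gcongr
  · exact one_div_nonneg.2 hst.nonneg
  · exact ENNReal.sum_le_tsum F
  · exact one_div_nonneg.2 hst.symm.nonneg
  · exact ENNReal.sum_le_tsum F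

/-- A discrete Hardy inequality with geometric weights. -/
theorem tsum_hardy_le {q s : ℝ} (hq : 0 < q) (hs : 0 < s) (β : ℤ → ℝ≥0∞) :
    ∑' i : ℤ, 2 ^ ((i : ℝ) * q) * (∑' j : ℤ, (Ici i).indicator β j) ^ s ≤
      geomConst (q / (2 * s)) ^ s * geomConst (q / 2) * ∑' j : ℤ, 2 ^ ((j : ℝ) * q) * β j ^ s := by
  -- Half of the weight is spent on bounding the tail sum by its largest weighted term.
  set ε : ℝ := q / (2 * s) with hε
  have hε0 : 0 < ε := by positivity
  have hεs : ε * s = q / 2 := by rw [hε]; field_simp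
  set T : ℤ → ℝ≥0∞ := fun i => ∑' j : ℤ, (Ici i).indicator
    (fun j => 2 ^ ((j : ℝ) * (q / 2)) * β j ^ s) j with hT
  have h1 : ∀ i : ℤ, (∑' j : ℤ, (Ici i).indicator β j) ≤
      geomConst ε * 2 ^ ((i : ℝ) * (-ε)) * T i ^ (1 / s) := by
    intro i
    have hβ : ∀ j ∈ Ici i, β j ≤ 2 ^ ((j : ℝ) * (-ε)) * T i ^ (1 / s) := by
      intro j hj
      have h2 : 2 ^ ((j : ℝ) * ε) * β j ≤ T i ^ (1 / s) := by
        rw [one_div, ENNReal.le_rpow_inv_iff hs, ENNReal.mul_rpow_of_nonneg _ _ hs.le,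
          ← ENNReal.rpow_mul, mul_assoc, hεs]
        refine le_trans (le_of_eq ?_) (ENNReal.le_tsum j)
        rw [indicator_of_mem hj]
      calc β j = 2 ^ ((j : ℝ) * (-ε)) * (2 ^ ((j : ℝ) * ε) * β j) := by
            rw [← mul_assoc, ← two_rpow_add]
            simp
        _ ≤ _ := by gcongr
    calc ∑' j : ℤ, (Ici i).indicator β j
        ≤ ∑' j : ℤ, (Ici i).indicator (fun j => (2 : ℝ≥0∞) ^ ((j : ℝ) * (-ε))) j
            * T i ^ (1 / s) := by
          refine ENNReal.tsum_le_tsum fun j => ?_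
          by_cases hj : j ∈ Ici i
          · rw [indicator_of_mem hj, indicator_of_mem hj]; exact hβ j hj
          · rw [indicator_of_notMem hj]; exact zero_le
      _ ≤ _ := by
          rw [ENNReal.tsum_mul_right]
          gcongr
          have := tsum_indicator_two_rpow_le (s := -ε) (by linarith) (Ici i)
            (2 ^ ((i : ℝ) * (-ε))) (fun j hj => two_rpow_le (by
              have : (i : ℝ) ≤ j := by exact_mod_cast hj
              nlinarith))
          rwa [abs_neg, abs_of_pos hε0] at this
  calc ∑' i : ℤ, 2 ^ ((i : ℝ) * q) * (∑' j : ℤ, (Ici i).indicator β j) ^ s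
      ≤ ∑' i : ℤ, geomConst ε ^ s * (2 ^ ((i : ℝ) * (q / 2)) * T i) := by
        refine ENNReal.tsum_le_tsum fun i => ?_
        calc 2 ^ ((i : ℝ) * q) * (∑' j : ℤ, (Ici i).indicator β j) ^ s
            ≤ 2 ^ ((i : ℝ) * q) * (geomConst ε * 2 ^ ((i : ℝ) * (-ε)) * T i ^ (1 / s)) ^ s := by
              gcongr; exact h1 i
          _ = geomConst ε ^ s * ((2 ^ ((i : ℝ) * q) * 2 ^ (-((i : ℝ) * (q / 2)))) * T i) := by
              rw [ENNReal.mul_rpow_of_nonneg _ _ hs.le, ENNReal.mul_rpow_of_nonneg _ _ hs.le,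
                ← ENNReal.rpow_mul, ← ENNReal.rpow_mul, one_div_mul_cancel hs.ne',
                ENNReal.rpow_one, mul_assoc (i : ℝ), neg_mul, hεs, mul_neg]
              ring
          _ = _ := by
              rw [← two_rpow_add]
              congr 4
              ring
    _ = geomConst ε ^ s * ∑' j : ℤ, 2 ^ ((j : ℝ) * (q / 2)) * β j ^ s *
          ∑' i : ℤ, (Iic j).indicator (fun i => (2 : ℝ≥0∞) ^ ((i : ℝ) * (q / 2))) i := by
        rw [ENNReal.tsum_mul_left]
        simp only [hT, ← ENNReal.tsum_mul_left]
        rw [ENNReal.tsum_comm]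
        refine tsum_congr fun j => tsum_congr fun i => ?_
        by_cases hij : i ≤ j
        · rw [indicator_of_mem (by exact hij), indicator_of_mem (by exact hij)]
          ring
        · rw [indicator_of_notMem (by exact hij), indicator_of_notMem (by exact hij)]
          simp
    _ ≤ geomConst ε ^ s * ∑' j : ℤ, 2 ^ ((j : ℝ) * (q / 2)) * β j ^ s *
          (geomConst (q / 2) * 2 ^ ((j : ℝ) * (q / 2))) := by
        gcongr with j
        refine tsum_indicator_le_of_pos (by positivity) _ _ fun i hi => two_rpow_le ?_
        have : (i : ℝ) ≤ j := by exact_mod_cast hi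
        gcongr
    _ = _ := by
        rw [mul_assoc, ← ENNReal.tsum_mul_left (a := geomConst (q / 2))]
        congr 1
        refine tsum_congr fun j => ?_
        have : (2 : ℝ≥0∞) ^ ((j : ℝ) * q) = 2 ^ ((j : ℝ) * (q / 2)) * 2 ^ ((j : ℝ) * (q / 2)) := by
          rw [← two_rpow_add]; congr 1; ring
        rw [this]
        ring

/-! ### Monotone functions and Stieltjes integrals -/

/-- A set without a largest element has a cofinal sequence, since rationals separate its points. -/
theorem exists_countable_cofinal (S : Set ℝ) :
    ∃ T ⊆ S, T.Countable ∧ ∀ y ∈ S, ∃ x ∈ T, y ≤ x := by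
  classical
  by_cases hmax : ∃ m, IsGreatest S m
  · obtain ⟨m, hm⟩ := hmax
    exact ⟨{m}, by simpa using hm.1, countable_singleton m, fun y hy => ⟨m, rfl, hm.2 hy⟩⟩
  · have hlt : ∀ y ∈ S, ∃ z ∈ S, y < z := by
      intro y hy
      by_contra! hcon
      exact hmax ⟨y, hy, fun z hz => hcon z hz⟩
    let Q : Set ℚ := {q | ∃ z ∈ S, (q : ℝ) ≤ z}
    choose! f hf using fun (q : ℚ) (hq : q ∈ Q) => hq
    refine ⟨f '' Q, ?_, (to_countable Q).image f, fun y hy => ?_⟩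
    · rintro _ ⟨q, hq, rfl⟩
      exact (hf q hq).1
    · obtain ⟨z, hz, hyz⟩ := hlt y hy
      obtain ⟨q, hq1, hq2⟩ := exists_rat_btwn hyz
      have hq : q ∈ Q := ⟨z, hz, hq2.le⟩
      exact ⟨f q, mem_image_of_mem f hq, hq1.le.trans (hf q hq).2⟩

theorem exists_countable_coinitial (S : Set ℝ) :
    ∃ T ⊆ S, T.Countable ∧ ∀ y ∈ S, ∃ x ∈ T, x ≤ y := by
  obtain ⟨T, hTS, hT, h⟩ := exists_countable_cofinal (-S)
  refine ⟨-T, by simpa using neg_subset_neg.2 hTS, by simpa using hT.image Neg.neg, fun y hy => ?_⟩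
  obtain ⟨x, hx, hyx⟩ := h (-y) (by simpa using hy)
  exact ⟨-x, by simpa using hx, by linarith⟩

/-- A set bounded in measure by the traces of the rays starting at its points. -/
theorem measure_le_of_forall_Ici (lam : Measure ℝ) (K : Set ℝ) (M : ℝ≥0∞)
    (h : ∀ x ∈ K, lam (K ∩ Ici x) ≤ M) : lam K ≤ M := by
  obtain ⟨T, hTK, hT, hcof⟩ := exists_countable_coinitial K
  have hsub : K ⊆ ⋃ x ∈ T, K ∩ Ici x := by
    intro y hy
    obtain ⟨x, hx, hxy⟩ := hcof y hy
    exact mem_biUnion hx ⟨hy, hxy⟩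
  refine (measure_mono hsub).trans ?_
  rw [measure_biUnion_eq_iSup hT]
  · exact iSup₂_le fun x hx => h x (hTK hx)
  · intro x hx y hy
    rcases le_total x y with hxy | hxy
    · exact ⟨x, hx, subset_rfl, inter_subset_inter_right _ (Ici_subset_Ici.2 hxy)⟩
    · exact ⟨y, hy, inter_subset_inter_right _ (Ici_subset_Ici.2 hxy), subset_rfl⟩

/-- A set bounded in measure by the traces of the rays ending at almost all of its points. -/
theorem measure_le_of_ae_Iic (lam : Measure ℝ) (K : Set ℝ) (M : ℝ≥0∞)
    (h : ∀ᵐ x ∂lam, x ∈ K → lam (K ∩ Iic x) ≤ M) : lam K ≤ M := by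
  set K' : Set ℝ := {x ∈ K | lam (K ∩ Iic x) ≤ M} with hK'
  have hle : lam K ≤ lam K' := by
    refine measure_mono_ae ?_
    filter_upwards [h] with x hx hxK
    exact ⟨hxK, hx hxK⟩
  obtain ⟨T, hTK, hT, hcof⟩ := exists_countable_cofinal K'
  have hsub : K' ⊆ ⋃ x ∈ T, K ∩ Iic x := by
    intro y hy
    obtain ⟨x, hx, hxy⟩ := hcof y hy
    exact mem_biUnion hx ⟨hy.1, hxy⟩
  refine hle.trans ((measure_mono hsub).trans ?_)
  rw [measure_biUnion_eq_iSup hT]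
  · exact iSup₂_le fun x hx => (hTK hx).2
  · intro x hx y hy
    rcases le_total x y with hxy | hxy
    · exact ⟨y, hy, inter_subset_inter_right _ (Iic_subset_Iic.2 hxy), subset_rfl⟩
    · exact ⟨x, hx, subset_rfl, inter_subset_inter_right _ (Iic_subset_Iic.2 hxy)⟩

theorem le_rpow_neg_iff {r : ℝ} (hr : 0 < r) {M v : ℝ≥0∞} :
    M ≤ v ^ (-r) ↔ v ≤ (M⁻¹) ^ r⁻¹ := by
  rw [ENNReal.rpow_neg, ENNReal.le_inv_iff_le_inv, ENNReal.le_rpow_inv_iff hr]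

theorem rpow_neg_antitone {r : ℝ} (hr : 0 < r) {x y : ℝ≥0∞} (h : x ≤ y) : y ^ (-r) ≤ x ^ (-r) := by
  rw [ENNReal.rpow_neg, ENNReal.rpow_neg]
  exact ENNReal.inv_le_inv.2 (ENNReal.rpow_le_rpow h hr.le)

/-- The integrator `-V ^ (-r)`. -/
noncomputable def negPow (V : ℝ → ℝ≥0∞) (r : ℝ) : ℝ → EReal :=
  fun x => -((V x ^ (-r) : ℝ≥0∞) : EReal)

theorem negPow_eq_bot_iff {V : ℝ → ℝ≥0∞} {r : ℝ} (hr : 0 < r) {x : ℝ} :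
    negPow V r x = ⊥ ↔ V x = 0 := by
  rw [negPow, EReal.neg_eq_bot_iff, EReal.coe_ennreal_eq_top_iff, ENNReal.rpow_eq_top_iff]
  constructor
  · rintro (h | h)
    · exact h.1
    · linarith [h.2]
  · exact fun h => Or.inl ⟨h, by linarith⟩

theorem negPow_ne_top {V : ℝ → ℝ≥0∞} {r : ℝ} {x : ℝ} : negPow V r x ≠ ⊤ := by
  rw [negPow, Ne, EReal.neg_eq_top_iff]
  exact EReal.coe_ennreal_ne_bot _

theorem negPow_toReal {V : ℝ → ℝ≥0∞} {r : ℝ} {x : ℝ} :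
    (negPow V r x).toReal = -(V x ^ (-r)).toReal := by
  rw [negPow, EReal.toReal_neg_eq, EReal.toReal_coe_ennreal]

theorem negPow_monotone {V : ℝ → ℝ≥0∞} (hV : Monotone V) {r : ℝ} (hr : 0 < r) :
    Monotone (negPow V r) := by
  intro x y hxy
  rw [negPow, negPow, EReal.neg_le_neg_iff, EReal.coe_ennreal_le_coe_ennreal_iff]
  exact rpow_neg_antitone hr (hV hxy)

theorem clampFun_negPow {V : ℝ → ℝ≥0∞} {r α β x : ℝ} (hx : x ∈ Icc α β) :
    clampFun (negPow V r) α β x = -(V x ^ (-r)).toReal := by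
  rw [clampFun, min_eq_left hx.2, max_eq_right hx.1, negPow_toReal]

theorem clampFun_negPow_nonpos {V : ℝ → ℝ≥0∞} {r α β x : ℝ} :
    clampFun (negPow V r) α β x ≤ 0 := by
  rw [clampFun, negPow_toReal]
  simp

/-- As `-V ^ (-r)` is at most `0`, its mass on `(y, β]` is at most `V y ^ (-r)`. -/
theorem lsMeasure_Ioc_le {V : ℝ → ℝ≥0∞} {r α β y : ℝ} (hy : y ∈ Icc α β) :
    lsMeasure (negPow V r) α β (Ioc y β) ≤ V y ^ (-r) := by
  rw [lsMeasure]
  split_ifs with hm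
  · rw [StieltjesFunction.measure_Ioc]
    refine le_trans (ENNReal.ofReal_le_ofReal ?_) ENNReal.ofReal_toReal_le
    rw [hm.stieltjesFunction_eq, hm.stieltjesFunction_eq]
    have h1 : Function.rightLim (clampFun (negPow V r) α β) β ≤ 0 :=
      (hm.rightLim_le (lt_add_one β)).trans clampFun_negPow_nonpos
    have h2 := hm.le_rightLim (le_refl y)
    rw [clampFun_negPow hy] at h2
    linarith
  · simp

/-- The Stieltjes measure of `-V ^ (-r)` gives `[x, y]` at least the mass
`V(x-) ^ (-r) - V y ^ (-r)`; here `v` is any bound for `V` on the left of `x`. -/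
theorem rpow_neg_le_lsMeasure_add {V : ℝ → ℝ≥0∞} (hV : Monotone V) {r α β x y : ℝ} (hr : 0 < r)
    (hα : V α ≠ 0) (hx : α < x) (hxy : x ≤ y) (hy : y < β) {v : ℝ≥0∞}
    (hv : ∀ z, α < z → z < x → V z ≤ v) :
    v ^ (-r) ≤ lsMeasure (negPow V r) α β (Icc x y) + V y ^ (-r) := by
  have hm : Monotone (clampFun (negPow V r) α β) :=
    clampFun_monotone (by linarith) ((negPow_monotone hV hr).monotoneOn _)
      (by rwa [Ne, negPow_eq_bot_iff hr]) negPow_ne_top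
  have hVfin : ∀ z, α ≤ z → V z ^ (-r) ≠ ∞ := fun z hz =>
    fun htop => by
      rcases ENNReal.rpow_eq_top_iff.1 htop with h | h
      · exact hα (le_antisymm ((hV hz).trans h.1.le) zero_le)
      · linarith [h.2]
  have hvfin : v ^ (-r) ≠ ∞ := by
    obtain ⟨z, hz1, hz2⟩ := exists_between hx
    exact ne_top_of_le_ne_top (hVfin z hz1.le) (rpow_neg_antitone hr (hv z hz1 hz2))
  rw [lsMeasure, dif_pos hm, StieltjesFunction.measure_Icc]
  have h1 : -(V y ^ (-r)).toReal ≤ hm.stieltjesFunction y := by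
    rw [hm.stieltjesFunction_eq, ← clampFun_negPow (α := α) (β := β) ⟨by linarith, by linarith⟩]
    exact hm.le_rightLim le_rfl
  have h2 : Function.leftLim hm.stieltjesFunction x ≤ -(v ^ (-r)).toReal := by
    rw [hm.stieltjesFunction.mono.leftLim_eq_sSup]
    refine csSup_le ((nonempty_Iio).image _) ?_
    rintro _ ⟨z, hz, rfl⟩
    obtain ⟨z', hz1, hz2⟩ := exists_between (max_lt hz hx)
    rw [hm.stieltjesFunction_eq]
    refine (hm.rightLim_le ((le_max_left _ _).trans_lt hz1)).trans ?_
    have hαz : α < z' := (le_max_right _ _).trans_lt hz1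
    rw [clampFun_negPow ⟨hαz.le, by linarith⟩, neg_le_neg_iff]
    exact ENNReal.toReal_mono (hVfin z' hαz.le) (rpow_neg_antitone hr (hv z' hαz hz2))
  calc v ^ (-r) = ENNReal.ofReal (v ^ (-r)).toReal := (ENNReal.ofReal_toReal hvfin).symm
    _ ≤ ENNReal.ofReal ((hm.stieltjesFunction y - Function.leftLim hm.stieltjesFunction x)
          + (V y ^ (-r)).toReal) := ENNReal.ofReal_le_ofReal (by linarith)
    _ ≤ _ := ENNReal.ofReal_add_le
    _ = _ := by rw [ENNReal.ofReal_toReal (hVfin y (by linarith))]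

theorem rIoo_ordConnected {a b : EReal} {x y z : ℝ} (hx : x ∈ rIoo a b) (hz : z ∈ rIoo a b)
    (hxy : x ≤ y) (hyz : y ≤ z) : y ∈ rIoo a b :=
  ⟨hx.1.trans_le (EReal.coe_le_coe_iff.2 hxy), (EReal.coe_le_coe_iff.2 hyz).trans_lt hz.2⟩

theorem exists_gt_mem_rIoo {a b : EReal} {x : ℝ} (hx : x ∈ rIoo a b) : ∃ y > x, y ∈ rIoo a b := by
  obtain ⟨y, hy1, hy2⟩ := EReal.lt_iff_exists_real_btwn.1 hx.2
  exact ⟨y, EReal.coe_lt_coe_iff.1 hy1, hx.1.trans hy1, hy2⟩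

/-- The left limit `V(x-)` of a non-decreasing `V`, computed within `(a, b)`: it is `0` if there are
no points of `(a, b)` on the left of `x`. -/
noncomputable def leftSup (a b : EReal) (V : ℝ → ℝ≥0∞) (x : ℝ) : ℝ≥0∞ :=
  ⨆ (y : ℝ) (_ : y ∈ rIoo a b) (_ : y < x), V y

/-- The supremum of `V(x-) ^ (-r)` over the final segment `{W > 2 ^ k}` of `(a, b)` (`0` if it
is empty). Up to the mass that is missing at `b`, this is the Stieltjes measure of the segment. -/
noncomputable def layerSup (a b : EReal) (V W : ℝ → ℝ≥0∞) (r : ℝ) (k : ℤ) : ℝ≥0∞ :=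
  ⨆ (x : ℝ) (_ : x ∈ rIoo a b) (_ : (2 : ℝ≥0∞) ^ (k : ℝ) < W x), leftSup a b V x ^ (-r)

/-- The supremum of `W` over the initial segment `{x | V(x-) < 2 ^ j}` of `(a, b)`. -/
noncomputable def levelSup (a b : EReal) (V W : ℝ → ℝ≥0∞) (j : ℤ) : ℝ≥0∞ :=
  ⨆ (x : ℝ) (_ : x ∈ rIoo a b) (_ : leftSup a b V x < (2 : ℝ≥0∞) ^ (j : ℝ)), W x

/-- The discrete form of `∫ W ^ r d(-V ^ (-r))`, which replaces `V` by its dyadic levels. -/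
noncomputable def levelSum (a b : EReal) (V W : ℝ → ℝ≥0∞) (r : ℝ) : ℝ≥0∞ :=
  ∑' j : ℤ, 2 ^ ((j : ℝ) * (-r)) * levelSup a b V W j ^ r

section LayerSums

variable {a b : EReal} {V W : ℝ → ℝ≥0∞} {r : ℝ}

theorem le_leftSup_rpow_neg (hr : 0 < r) (hV : Monotone V) {α x : ℝ} (hαx : α < x) {M : ℝ≥0∞}
    (h : ∀ y, α < y → y < x → M ≤ V y ^ (-r)) :
    M ≤ leftSup a b V x ^ (-r) := by
  rw [le_rpow_neg_iff hr]
  refine iSup_le fun y => iSup_le fun hy => iSup_le fun hyx => ?_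
  obtain ⟨z, hz1, hz2⟩ := exists_between (max_lt hyx hαx)
  rw [max_lt_iff] at hz1
  exact (hV hz1.1.le).trans ((le_rpow_neg_iff hr).1 (h z hz1.2 hz2))

/-- Layering `W` in the sum over the levels of `V` interchanges the roles of the two functions. -/
theorem levelSum_le_layerSup (hr : 0 < r) :
    levelSum a b V W r ≤
      2 ^ r * geomConst r * ∑' k : ℤ, 2 ^ ((k : ℝ) * r) * layerSup a b V W r k := by
  have := tsum_rpow_le_layer hr (t := -r) (by linarith) (levelSup a b V W)
    (layerSup a b V W r) ?_
  · rwa [abs_neg, abs_of_pos hr] at this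
  · intro k j hkj
    simp only [levelSup, lt_iSup_iff] at hkj
    obtain ⟨x, hx, hxj, hxk⟩ := hkj
    refine le_trans ?_ (le_iSup₂_of_le x hx (le_iSup_of_le hxk le_rfl))
    rw [ENNReal.rpow_mul]
    exact rpow_neg_antitone hr hxj.le

/-- The dyadic layers of `v⁻¹`, indexed by the negated exponent. -/
theorem rpow_neg_le_tsum (hr : 0 < r) (v : ℝ≥0∞) :
    v ^ (-r) ≤ 2 ^ r * ∑' j : ℤ, {j : ℤ | v < (2 : ℝ≥0∞) ^ (j : ℝ)}.indicator
      (fun j => (2 : ℝ≥0∞) ^ ((j : ℝ) * (-r))) j := by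
  rw [ENNReal.rpow_neg, ← ENNReal.inv_rpow]
  refine (rpow_le_tsum_layer hr v⁻¹).trans (le_of_eq ?_)
  congr 1
  rw [← (Equiv.neg ℤ).tsum_eq]
  refine tsum_congr fun j => ?_
  have hiff : (2 : ℝ≥0∞) ^ (-(j : ℝ)) < v⁻¹ ↔ v < 2 ^ (j : ℝ) := by
    rw [ENNReal.rpow_neg, ENNReal.inv_lt_inv]
  by_cases hj : v < 2 ^ (j : ℝ)
  · rw [indicator_of_mem (show j ∈ {j : ℤ | v < (2 : ℝ≥0∞) ^ (j : ℝ)} from hj),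
      indicator_of_mem]
    · simp
    · simpa only [Equiv.neg_apply, mem_ofPred_eq, Int.cast_neg] using hiff.2 hj
  · rw [indicator_of_notMem (show j ∉ {j : ℤ | v < (2 : ℝ≥0∞) ^ (j : ℝ)} from hj),
      indicator_of_notMem]
    simpa only [Equiv.neg_apply, mem_ofPred_eq, Int.cast_neg] using fun h => hj (hiff.1 h)

theorem layerSup_le_levelSum (hr : 0 < r) :
    ∑' k : ℤ, 2 ^ ((k : ℝ) * r) * layerSup a b V W r k ≤
      2 ^ r * geomConst r * levelSum a b V W r := by
  have h := layer_le_tsum_rpow hr (t := -r) (levelSup a b V W)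
    (fun k => 2 ^ (-r) * layerSup a b V W r k) ?_
  · calc ∑' k : ℤ, 2 ^ ((k : ℝ) * r) * layerSup a b V W r k
        = 2 ^ r * ∑' k : ℤ, 2 ^ ((k : ℝ) * r) * (2 ^ (-r) * layerSup a b V W r k) := by
          rw [← ENNReal.tsum_mul_left]
          refine tsum_congr fun k => ?_
          have : (2 : ℝ≥0∞) ^ r * 2 ^ (-r) = 1 := by rw [← two_rpow_add]; simp
          calc _ = (2 ^ r * 2 ^ (-r)) * (2 ^ ((k : ℝ) * r) * layerSup a b V W r k) := by
                rw [this, one_mul]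
            _ = _ := by ring
      _ ≤ _ := by rw [mul_assoc]; gcongr; exact h
  · intro k
    have h2 : (2 : ℝ≥0∞) ^ (-r) * 2 ^ r = 1 := by rw [← two_rpow_add]; simp
    calc 2 ^ (-r) * layerSup a b V W r k
        ≤ 2 ^ (-r) * (2 ^ r * ∑' j : ℤ, {j : ℤ | (2 : ℝ≥0∞) ^ (k : ℝ) <
            levelSup a b V W j}.indicator (fun j => (2 : ℝ≥0∞) ^ ((j : ℝ) * (-r))) j) := by
          gcongr
          refine iSup_le fun x => iSup_le fun hx => iSup_le fun hxk => ?_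
          refine (rpow_neg_le_tsum hr _).trans ?_
          gcongr 2 ^ r * ?_
          refine ENNReal.tsum_le_tsum fun j =>
            indicator_le_indicator_of_subset (fun j hj => ?_) (fun _ => zero_le) j
          exact hxk.trans_le (le_iSup₂_of_le x hx (le_iSup_of_le hj le_rfl))
      _ = _ := by rw [← mul_assoc, h2, one_mul]

/-- The boundary term of `A₂` is dominated by the sum over the layers of `W`. -/
theorem sup_mul_inv_rpow_le_layerSup (hr : 0 < r) {Wb Vb : ℝ≥0∞}
    (hW : Wb = ⨆ (x : ℝ) (_ : x ∈ rIoo a b), W x) (hV : Vb = ⨆ (x : ℝ) (_ : x ∈ rIoo a b), V x) :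
    (Wb * Vb⁻¹) ^ r ≤ 2 ^ r * ∑' k : ℤ, 2 ^ ((k : ℝ) * r) * layerSup a b V W r k := by
  rw [ENNReal.mul_rpow_of_nonneg _ _ hr.le, ENNReal.inv_rpow, ← ENNReal.rpow_neg]
  calc Wb ^ r * Vb ^ (-r)
      ≤ (2 ^ r * ∑' k : ℤ, {k : ℤ | (2 : ℝ≥0∞) ^ (k : ℝ) < Wb}.indicator
        (fun k => (2 : ℝ≥0∞) ^ ((k : ℝ) * r)) k) * Vb ^ (-r) := by
        gcongr
        exact rpow_le_tsum_layer hr Wb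
    _ = 2 ^ r * ∑' k : ℤ, {k : ℤ | (2 : ℝ≥0∞) ^ (k : ℝ) < Wb}.indicator
        (fun k => (2 : ℝ≥0∞) ^ ((k : ℝ) * r)) k * Vb ^ (-r) := by
        rw [mul_assoc, ENNReal.tsum_mul_right]
    _ ≤ _ := by
        refine mul_le_mul_right (ENNReal.tsum_le_tsum fun k => ?_) _
        by_cases hk : (2 : ℝ≥0∞) ^ (k : ℝ) < Wb
        · rw [indicator_of_mem (show k ∈ {k : ℤ | (2 : ℝ≥0∞) ^ (k : ℝ) < Wb} from hk)]
          refine mul_le_mul_right ?_ _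
          rw [hW] at hk
          simp only [lt_iSup_iff] at hk
          obtain ⟨x, hx, hxk⟩ := hk
          refine le_trans (rpow_neg_antitone hr ?_)
            (le_iSup₂_of_le x hx (le_iSup_of_le hxk le_rfl))
          rw [hV]
          exact iSup₂_mono fun y hy => iSup_le fun _ => le_rfl
        · rw [indicator_of_notMem (show k ∉ {k : ℤ | (2 : ℝ≥0∞) ^ (k : ℝ) < Wb} from hk)]
          simp

theorem le_botEnd_imp {h : ℝ → EReal} {x y : ℝ} (hx : x ∈ rIoo a b)
    (hxc : (x : EReal) ≤ botEnd a b h) (hyx : y < x) : ∃ z ∈ rIoo a b, y < z ∧ h z = ⊥ := by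
  have hlt : (y : EReal) ⊔ a < botEnd a b h :=
    lt_of_lt_of_le (max_lt (EReal.coe_lt_coe_iff.2 hyx) hx.1) hxc
  rw [botEnd, lt_sup_iff] at hlt
  rcases hlt with h1 | h1
  · exact absurd h1 (not_lt.2 le_sup_right)
  · obtain ⟨_, ⟨z, hz, rfl⟩, hlt⟩ := lt_sSup_iff.1 h1
    exact ⟨z, hz.1, EReal.coe_lt_coe_iff.1 (le_sup_left.trans_lt hlt), hz.2⟩

/-- Points where the Stieltjes integral demands `W = 0` are those with `V(x-) = 0`. -/
theorem leftSup_eq_zero (hr : 0 < r) (hV : Monotone V) {x : ℝ} (hx : x ∈ rIoo a b)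
    (hxc : (x : EReal) ≤ botEnd a b (negPow V r)) : leftSup a b V x = 0 := by
  refine le_antisymm (iSup_le fun y => iSup_le fun _ => iSup_le fun hyx => ?_) zero_le
  obtain ⟨z, -, hyz, hz⟩ := le_botEnd_imp hx hxc hyx
  rw [negPow_eq_bot_iff hr] at hz
  exact (hV hyz.le).trans hz.le

theorem ne_zero_of_botEnd_lt (hr : 0 < r) {x : ℝ} (hx : x ∈ rIoo a b)
    (hxc : botEnd a b (negPow V r) < (x : EReal)) : V x ≠ 0 := by
  intro h0
  refine (not_le.2 hxc) (le_sup_of_le_right (le_sSup ⟨x, ⟨hx, ?_⟩, rfl⟩))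
  rwa [negPow_eq_bot_iff hr]

theorem le_botEnd (h : ℝ → EReal) : a ≤ botEnd a b h := le_sup_left

/-- The Stieltjes integral is dominated by the sum over the layers of `W`; if it is undefined, then
some layer contains a point with `V(x-) = 0` and the sum is infinite as well. -/
theorem lsIntegral_le_layerSup (hr : 0 < r) (hV : Monotone V) (hW : Monotone W) :
    lsIntegral a b (fun x => W x ^ r) (negPow V r) ≤
      2 ^ r * ∑' k : ℤ, 2 ^ ((k : ℝ) * r) * layerSup a b V W r k := by
  rw [lsIntegral]
  split_ifs with hcond
  · refine iSup_le fun α => iSup_le fun β => iSup_le fun hα => iSup_le fun hαβ =>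
      iSup_le fun hβ => ?_
    have hαI : α ∈ rIoo a b := ⟨(le_botEnd _).trans_lt hα, (EReal.coe_lt_coe_iff.2 hαβ).trans hβ⟩
    have hβI : β ∈ rIoo a b := ⟨hαI.1.trans (EReal.coe_lt_coe_iff.2 hαβ), hβ⟩
    refine (lintegral_rpow_le_layer _ hW.measurable hr).trans ?_
    gcongr with k
    rw [Measure.restrict_apply (measurableSet_lt measurable_const hW.measurable)]
    refine measure_le_of_forall_Ici _ _ _ fun x hx => ?_
    have hxI : x ∈ rIoo a b := rIoo_ordConnected hαI hβI hx.2.1.le hx.2.2.le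
    refine le_trans ?_ (le_iSup₂_of_le x hxI (le_iSup_of_le hx.1 le_rfl))
    refine le_leftSup_rpow_neg hr hV hx.2.1 fun y hy1 hy2 => ?_
    refine le_trans (measure_mono ?_) (lsMeasure_Ioc_le (α := α) ⟨hy1.le, hy2.le.trans hx.2.2.le⟩)
    exact fun z hz => ⟨hy2.trans_le hz.2, hz.1.2.2.le⟩
  · push Not at hcond
    obtain ⟨x, hx, hxc, hWx⟩ := hcond
    have hWx0 : W x ≠ 0 := fun h0 => hWx (by rw [h0, ENNReal.zero_rpow_of_pos hr])
    obtain ⟨k, hk⟩ : ∃ k : ℤ, (2 : ℝ≥0∞) ^ (k : ℝ) < W x := by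
      rcases eq_or_ne (W x) ∞ with ht | ht
      · exact ⟨0, by simp [ht]⟩
      · obtain ⟨k, hk, -⟩ := exists_two_rpow_lt_le hWx0 ht
        exact ⟨k, hk⟩
    have hlay : layerSup a b V W r k = ∞ := by
      refine top_unique (le_iSup₂_of_le x hx (le_iSup_of_le hk ?_))
      rw [leftSup_eq_zero hr hV hx hxc, ENNReal.zero_rpow_of_neg (by linarith)]
    refine le_of_le_of_eq le_top (Eq.symm (ENNReal.mul_eq_top.2 (Or.inl ⟨two_rpow_ne_zero r, ?_⟩)))
    refine top_unique (le_trans (le_of_eq ?_) (ENNReal.le_tsum k))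
    rw [hlay, ENNReal.mul_top (two_rpow_ne_zero _)]

/-- The sum over the layers of `W` is dominated by the Stieltjes integral and the boundary term. On
a compact subinterval ending at `y` each layer misses at most the mass `V y ^ (-r)`, and it is this
missing mass that the boundary term pays for as `y` tends to `b`. -/
theorem layerSup_le_lsIntegral (hr : 0 < r) (hV : Monotone V) (hW : Monotone W) {Wb Vb : ℝ≥0∞}
    (hWb : Wb = ⨆ (x : ℝ) (_ : x ∈ rIoo a b), W x)
    (hVb : Vb = ⨆ (x : ℝ) (_ : x ∈ rIoo a b), V x) :
    ∑' k : ℤ, 2 ^ ((k : ℝ) * r) * layerSup a b V W r k ≤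
      geomConst r * (lsIntegral a b (fun x => W x ^ r) (negPow V r) + (Wb * Vb⁻¹) ^ r) := by
  have hg0 : geomConst r ≠ 0 := (zero_lt_one.trans_le (one_le_geomConst r)).ne'
  rw [lsIntegral]
  split_ifs with hcond
  swap
  · rw [top_add, ENNReal.mul_top hg0]; exact le_top
  set c := botEnd a b (negPow V r) with hc
  -- Points of `(c, b)` are enough, as `W = 0` elsewhere.
  have hKc : ∀ x ∈ rIoo a b, ∀ k : ℤ, (2 : ℝ≥0∞) ^ (k : ℝ) < W x → c < x := by
    intro x hx k hk
    by_contra! hxc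
    have := hcond x hx hxc
    rw [ENNReal.rpow_eq_zero_iff_of_pos hr] at this
    rw [this] at hk
    exact not_lt_zero hk
  let P := {z : ℝ × ℝ // c < z.1 ∧ z.1 < z.2 ∧ (z.2 : EReal) < b}
  let φ : ℤ → P → ℝ≥0∞ := fun k z => ⨆ (x : ℝ) (_ : x ∈ Ioc z.1.1 z.1.2)
    (_ : (2 : ℝ≥0∞) ^ (k : ℝ) < W x), leftSup a b V x ^ (-r)
  have hmemI : ∀ z : ℝ, c < z → (z : EReal) < b → z ∈ rIoo a b := fun z h1 h2 =>
    ⟨(le_botEnd _).trans_lt h1, h2⟩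
  have hlay : ∀ k, layerSup a b V W r k ≤ ⨆ z : P, φ k z := by
    intro k
    refine iSup_le fun x => iSup_le fun hx => iSup_le fun hxk => ?_
    have hcx := hKc x hx k hxk
    obtain ⟨α, hα1, hα2⟩ := EReal.lt_iff_exists_real_btwn.1 hcx
    exact le_iSup_of_le (⟨(α, x), hα1, EReal.coe_lt_coe_iff.1 hα2, hx.2⟩ : P)
      (le_iSup₂_of_le x ⟨EReal.coe_lt_coe_iff.1 hα2, le_rfl⟩ (le_iSup_of_le hxk le_rfl))
  rw [ENNReal.tsum_eq_iSup_sum]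
  refine iSup_le fun F => ?_
  set S : Set ℤ := {k : ℤ | (2 : ℝ≥0∞) ^ (k : ℝ) < Wb} with hS
  set B : ℝ≥0∞ := ∑ k ∈ F, S.indicator (fun k => (2 : ℝ≥0∞) ^ ((k : ℝ) * r)) k with hB
  have hBtop : B ≠ ∞ := by
    refine ENNReal.sum_ne_top.2 fun k _ => ?_
    exact ne_top_of_le_ne_top (two_rpow_ne_top _) (indicator_le_self' (fun _ _ => zero_le) k)
  have hBW : B ≤ geomConst r * Wb ^ r := (ENNReal.sum_le_tsum F).trans (tsum_layer_le hr Wb)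
  set Lam := lsIntegralFin c b (fun x => W x ^ r) (negPow V r)
  have hmono : ∀ (k : ℤ) (z z' : P), z'.1.1 ≤ z.1.1 → z.1.2 ≤ z'.1.2 → φ k z ≤ φ k z' := by
    intro k z z' h1 h2
    refine iSup_le fun x => iSup_le fun hx => ?_
    exact le_iSup₂_of_le x ⟨h1.trans_lt hx.1, hx.2.trans h2⟩ le_rfl
  -- For finitely many layers `B` is finite, so that `y → b` is harmless in `B * V y ^ (-r)`.
  have hstep : ∀ z : P, ∑ k ∈ F, 2 ^ ((k : ℝ) * r) * φ k z ≤
      geomConst r * Lam + B * V z.1.2 ^ (-r) := by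
    rintro ⟨⟨α, y⟩, hα, hαy, hy⟩
    simp only at hα hαy hy
    obtain ⟨β, hβ1, hβ2⟩ := EReal.lt_iff_exists_real_btwn.1 hy
    rw [EReal.coe_lt_coe_iff] at hβ1
    have hαI := hmemI α hα ((EReal.coe_lt_coe_iff.2 hαy).trans hy)
    have hyI := hmemI y (hα.trans (EReal.coe_lt_coe_iff.2 hαy)) hy
    have hφ : ∀ k : ℤ, 2 ^ ((k : ℝ) * r) * φ k ⟨(α, y), hα, hαy, hy⟩ ≤
        2 ^ ((k : ℝ) * r) * ((lsMeasure (negPow V r) α β).restrict (Ioo α β))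
          {x | (2 : ℝ≥0∞) ^ (k : ℝ) < W x} +
        S.indicator (fun k => (2 : ℝ≥0∞) ^ ((k : ℝ) * r)) k * V y ^ (-r) := by
      intro k
      rw [ENNReal.mul_iSup]
      refine iSup_le fun x => ?_
      rw [ENNReal.mul_iSup]
      refine iSup_le fun hx => ?_
      rw [ENNReal.mul_iSup]
      refine iSup_le fun hxk => ?_
      simp only at hx
      have hxI : x ∈ rIoo a b := rIoo_ordConnected hαI hyI hx.1.le hx.2
      have hkS : k ∈ S := by
        refine lt_of_lt_of_le hxk ?_
        rw [hWb]
        exact le_iSup₂_of_le x hxI le_rfl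
      rw [indicator_of_mem hkS, ← mul_add]
      gcongr
      refine (rpow_neg_le_lsMeasure_add hV hr (ne_zero_of_botEnd_lt hr hαI hα) hx.1 hx.2 hβ1
        fun z hz1 hz2 => ?_).trans ?_
      · exact le_iSup₂_of_le z (rIoo_ordConnected hαI hxI hz1.le hz2.le) (le_iSup_of_le hz2 le_rfl)
      · refine add_le_add_left ?_ _
        rw [Measure.restrict_apply (measurableSet_lt measurable_const hW.measurable)]
        exact measure_mono fun z hz =>
          ⟨hxk.trans_le (hW hz.1), hx.1.trans_le hz.1, hz.2.trans_lt hβ1⟩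
    calc ∑ k ∈ F, 2 ^ ((k : ℝ) * r) * φ k ⟨(α, y), hα, hαy, hy⟩
        ≤ ∑ k ∈ F, (2 ^ ((k : ℝ) * r) * ((lsMeasure (negPow V r) α β).restrict (Ioo α β))
          {x | (2 : ℝ≥0∞) ^ (k : ℝ) < W x} +
          S.indicator (fun k => (2 : ℝ≥0∞) ^ ((k : ℝ) * r)) k * V y ^ (-r)) :=
          Finset.sum_le_sum fun k _ => hφ k
      _ = ∑ k ∈ F, (2 ^ ((k : ℝ) * r) * ((lsMeasure (negPow V r) α β).restrict (Ioo α β))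
          {x | (2 : ℝ≥0∞) ^ (k : ℝ) < W x}) + B * V y ^ (-r) := by
          rw [Finset.sum_add_distrib, hB, Finset.sum_mul]
      _ ≤ geomConst r * Lam + B * V y ^ (-r) := by
          gcongr
          refine (ENNReal.sum_le_tsum F).trans
            ((layer_le_lintegral_rpow _ hW.measurable hr).trans ?_)
          gcongr
          exact le_iSup₂_of_le α β (le_iSup₂_of_le hα (hαy.trans hβ1) (le_iSup_of_le hβ2 le_rfl))
  have hstep' : ∀ z : P, ∑ k ∈ F, 2 ^ ((k : ℝ) * r) * φ k z ≤
      geomConst r * Lam + B * Vb ^ (-r) := by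
    intro z
    rcases eq_or_ne B 0 with hB0 | hB0
    · simpa [hB0] using hstep z
    have key : (∑ k ∈ F, 2 ^ ((k : ℝ) * r) * φ k z - geomConst r * Lam) / B ≤ Vb ^ (-r) := by
      rw [le_rpow_neg_iff hr, hVb]
      refine iSup₂_le fun y hy => ?_
      rw [← le_rpow_neg_iff hr, ENNReal.div_le_iff' hB0 hBtop, tsub_le_iff_left]
      -- Enlarge the interval so that its right end is beyond `y`.
      let z' : P := ⟨(z.1.1, max z.1.2 y), z.2.1, lt_max_of_lt_left z.2.2.1, by
        rcases max_choice z.1.2 y with h | h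
        · simp only [h]; exact z.2.2.2
        · simp only [h]; exact hy.2⟩
      calc ∑ k ∈ F, 2 ^ ((k : ℝ) * r) * φ k z ≤ ∑ k ∈ F, 2 ^ ((k : ℝ) * r) * φ k z' := by
            gcongr with k _
            exact hmono k z z' le_rfl (le_max_left _ _)
        _ ≤ geomConst r * Lam + B * V z'.1.2 ^ (-r) := hstep z'
        _ ≤ _ := by
            refine add_le_add_right (mul_le_mul_right ?_ _) _
            exact rpow_neg_antitone hr (hV (le_max_right _ _))
    rwa [ENNReal.div_le_iff' hB0 hBtop, tsub_le_iff_left] at key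
  calc ∑ k ∈ F, 2 ^ ((k : ℝ) * r) * layerSup a b V W r k
      ≤ ∑ k ∈ F, ⨆ z : P, 2 ^ ((k : ℝ) * r) * φ k z := by
        gcongr with k _
        rw [← ENNReal.mul_iSup]
        gcongr
        exact hlay k
    _ = ⨆ z : P, ∑ k ∈ F, 2 ^ ((k : ℝ) * r) * φ k z := by
        refine ENNReal.finsetSum_iSup fun z z' => ?_
        refine ⟨⟨(min z.1.1 z'.1.1, max z.1.2 z'.1.2), ?_, ?_, ?_⟩, fun k => ⟨?_, ?_⟩⟩
        · rcases min_choice z.1.1 z'.1.1 with h | h <;> simp only [h]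
          exacts [z.2.1, z'.2.1]
        · exact min_lt_of_left_lt (lt_max_of_lt_left z.2.2.1)
        · rcases max_choice z.1.2 z'.1.2 with h | h <;> simp only [h]
          exacts [z.2.2.2, z'.2.2.2]
        · gcongr
          exact hmono k _ _ (min_le_left _ _) (le_max_left _ _)
        · gcongr
          exact hmono k _ _ (min_le_right _ _) (le_max_right _ _)
    _ ≤ geomConst r * Lam + B * Vb ^ (-r) := iSup_le hstep'
    _ ≤ geomConst r * Lam + geomConst r * Wb ^ r * Vb ^ (-r) := by gcongr
    _ = _ := by
        rw [ENNReal.mul_rpow_of_nonneg _ _ hr.le, ENNReal.inv_rpow, ← ENNReal.rpow_neg]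
        ring

end LayerSums

/-! ### The functionals `qnorm` -/

theorem measurableSet_rIoo (a b : EReal) : MeasurableSet (rIoo a b) :=
  (measurableSet_Ioo (a := a) (b := b)).preimage measurable_coe_real_ereal

theorem measurableSet_rIoc (a b : EReal) : MeasurableSet (rIoc a b) :=
  (measurableSet_Ioc (a := a) (b := b)).preimage measurable_coe_real_ereal

theorem qnorm_eq_lintegral {p : ℝ≥0∞} (hp : 0 < p) (hp' : p < ∞) (f : ℝ → ℝ≥0∞) (E : Set ℝ)
    (μ : Measure ℝ) : qnorm f p E μ = (∫⁻ x in E, f x ^ p.toReal ∂μ) ^ (1 / p.toReal) := by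
  rw [qnorm, eLpNorm_eq_lintegral_rpow_enorm_toReal hp.ne' hp'.ne]
  simp only [enorm_eq_self]

theorem qnorm_rpow {p : ℝ≥0∞} (hp : 0 < p) (hp' : p < ∞) (f : ℝ → ℝ≥0∞) (E : Set ℝ)
    (μ : Measure ℝ) : qnorm f p E μ ^ p.toReal = ∫⁻ x in E, f x ^ p.toReal ∂μ := by
  rw [qnorm_eq_lintegral hp hp', ← ENNReal.rpow_mul,
    one_div_mul_cancel (ENNReal.toReal_pos hp.ne' hp'.ne).ne', ENNReal.rpow_one]

theorem qnorm_top (f : ℝ → ℝ≥0∞) (E : Set ℝ) (μ : Measure ℝ) :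
    qnorm f ∞ E μ = essSup f (μ.restrict E) := by
  rw [qnorm, eLpNorm_exponent_top, eLpNormEssSup_eq_essSup_enorm]
  simp only [enorm_eq_self]

theorem qnorm_mono_set {f : ℝ → ℝ≥0∞} {p : ℝ≥0∞} {E F : Set ℝ} {μ : Measure ℝ} (h : E ⊆ F) :
    qnorm f p E μ ≤ qnorm f p F μ :=
  eLpNorm_mono_measure _ (Measure.restrict_mono h le_rfl)

theorem qnorm_mono_ae {f g : ℝ → ℝ≥0∞} {p : ℝ≥0∞} {E : Set ℝ} {μ : Measure ℝ}
    (h : ∀ᵐ x ∂(μ.restrict E), f x ≤ g x) : qnorm f p E μ ≤ qnorm g p E μ :=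
  eLpNorm_mono_enorm_ae (by simpa only [enorm_eq_self] using h)

theorem qnorm_indicator {f : ℝ → ℝ≥0∞} {p : ℝ≥0∞} {E F : Set ℝ} {μ : Measure ℝ}
    (hE : MeasurableSet E) : qnorm (E.indicator f) p F μ = qnorm f p (E ∩ F) μ := by
  rw [qnorm, eLpNorm_indicator_eq_eLpNorm_restrict hE, Measure.restrict_restrict hE, qnorm]

theorem qnorm_const_mul {f : ℝ → ℝ≥0∞} {p : ℝ≥0∞} (hp : 0 < p) (hf : Measurable f) {E : Set ℝ}
    {μ : Measure ℝ} (c : ℝ≥0∞) : qnorm (fun x => c * f x) p E μ = c * qnorm f p E μ := by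
  rcases eq_or_ne p ∞ with rfl | hp'
  · rw [qnorm_top, qnorm_top, ENNReal.essSup_const_mul]
  · have hp0 := ENNReal.toReal_pos hp.ne' hp'
    rw [qnorm_eq_lintegral hp hp'.lt_top, qnorm_eq_lintegral hp hp'.lt_top]
    simp only [ENNReal.mul_rpow_of_nonneg _ _ hp0.le]
    rw [lintegral_const_mul _ (hf.pow_const _),
      ENNReal.mul_rpow_of_nonneg _ _ (by positivity), ← ENNReal.rpow_mul,
      mul_one_div_cancel hp0.ne', ENNReal.rpow_one]

theorem ae_le_qnorm_top (f : ℝ → ℝ≥0∞) (E : Set ℝ) (μ : Measure ℝ) :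
    ∀ᵐ x ∂(μ.restrict E), f x ≤ qnorm f ∞ E μ := by
  rw [qnorm_top]
  exact ae_le_essSup

theorem qnorm_top_le {f : ℝ → ℝ≥0∞} {E : Set ℝ} {μ : Measure ℝ} {M : ℝ≥0∞}
    (h : ∀ᵐ x ∂(μ.restrict E), f x ≤ M) : qnorm f ∞ E μ ≤ M := by
  rw [qnorm_top]
  exact essSup_le_of_ae_le M h

/-- The measure `f ^ p μ` on `E`. -/
noncomputable def powMeasure (f : ℝ → ℝ≥0∞) (p : ℝ) (E : Set ℝ) (μ : Measure ℝ) : Measure ℝ :=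
  (μ.restrict E).withDensity (fun x => f x ^ p)

theorem powMeasure_apply {p : ℝ≥0∞} (hp : 0 < p) (hp' : p < ∞) (f : ℝ → ℝ≥0∞) {E K : Set ℝ}
    (μ : Measure ℝ) (hK : MeasurableSet K) :
    powMeasure f p.toReal E μ K = qnorm f p (K ∩ E) μ ^ p.toReal := by
  rw [powMeasure, withDensity_apply _ hK, Measure.restrict_restrict hK, qnorm_rpow hp hp']

theorem lintegral_powMeasure {p : ℝ} {f h : ℝ → ℝ≥0∞} (hf : Measurable f)
    (hh : Measurable h) (hp : 0 ≤ p) (E : Set ℝ) (μ : Measure ℝ) :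
    ∫⁻ x, h x ^ p ∂(powMeasure f p E μ) = ∫⁻ x in E, (f x * h x) ^ p ∂μ := by
  rw [powMeasure, lintegral_withDensity_eq_lintegral_mul _ (hf.pow_const p) (hh.pow_const p)]
  simp only [Pi.mul_apply, ENNReal.mul_rpow_of_nonneg _ _ hp]

theorem qnorm_mul_rpow {p : ℝ≥0∞} (hp : 0 < p) (hp' : p < ∞) {f h : ℝ → ℝ≥0∞} (hf : Measurable f)
    (hh : Measurable h) (E : Set ℝ) (μ : Measure ℝ) :
    qnorm (fun x => f x * h x) p E μ ^ p.toReal =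
      ∫⁻ x, h x ^ p.toReal ∂(powMeasure f p.toReal E μ) := by
  rw [lintegral_powMeasure hf hh ENNReal.toReal_nonneg, qnorm_rpow hp hp']

theorem ae_powMeasure {f : ℝ → ℝ≥0∞} {p : ℝ} {E : Set ℝ} {μ : Measure ℝ} {P : ℝ → Prop}
    (h : ∀ᵐ x ∂(μ.restrict E), P x) : ∀ᵐ x ∂(powMeasure f p E μ), P x :=
  (withDensity_absolutelyContinuous _ _).ae_le h

/-- On a set the norm is the supremum of the norms over the traces of the rays
that end at almost all of its points. -/
theorem qnorm_le_of_ae_Iic {p : ℝ≥0∞} (hp : 0 < p) {f : ℝ → ℝ≥0∞}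
    {K : Set ℝ} (hK : MeasurableSet K) {μ : Measure ℝ} {M : ℝ≥0∞}
    (h : ∀ᵐ x ∂(μ.restrict K), qnorm f p (K ∩ Iic x) μ ≤ M) : qnorm f p K μ ≤ M := by
  rcases eq_or_ne p ∞ with rfl | hp'
  · refine qnorm_top_le ?_
    rw [ae_iff]
    refine le_antisymm ?_ zero_le
    have h1 : ∀ᵐ x ∂((μ.restrict K).restrict {x | ¬ f x ≤ M}),
        x ∈ (univ : Set ℝ) → ((μ.restrict K).restrict {x | ¬ f x ≤ M}) (univ ∩ Iic x) ≤ 0 := by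
      filter_upwards [ae_restrict_of_ae h] with x hx _
      have h2 : ∀ᵐ y ∂((μ.restrict K).restrict (Iic x)), f y ≤ M := by
        rw [Measure.restrict_restrict measurableSet_Iic, inter_comm]
        exact (ae_le_qnorm_top f (K ∩ Iic x) μ).mono fun y hy => hy.trans hx
      rw [ae_iff, Measure.restrict_apply' measurableSet_Iic] at h2
      rw [univ_inter, Measure.restrict_apply measurableSet_Iic, inter_comm, h2]
    have h3 := measure_le_of_ae_Iic _ univ 0 h1
    rwa [Measure.restrict_apply_univ] at h3
  · have hp'' := hp'.lt_top
    have hp0 := ENNReal.toReal_pos hp.ne' hp'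
    rw [← ENNReal.rpow_le_rpow_iff hp0, ← inter_self K, ← powMeasure_apply hp hp'' f μ hK]
    refine measure_le_of_ae_Iic _ _ _ ?_
    filter_upwards [ae_powMeasure h] with x hx _
    rw [powMeasure_apply hp hp'' f μ (hK.inter measurableSet_Iic)]
    refine ENNReal.rpow_le_rpow ((qnorm_mono_set ?_).trans hx) hp0.le
    exact inter_subset_left

theorem rIoc_mono {a : EReal} {x y : ℝ} (h : x ≤ y) : rIoc a x ⊆ rIoc a y :=
  fun _ hz => ⟨hz.1, hz.2.trans (EReal.coe_le_coe_iff.2 h)⟩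

theorem qnorm_rIoc_monotone (f : ℝ → ℝ≥0∞) (p : ℝ≥0∞) (a : EReal) (μ : Measure ℝ) :
    Monotone (fun x : ℝ => qnorm f p (rIoc a x) μ) :=
  fun _ _ h => qnorm_mono_set (rIoc_mono h)

theorem rIoc_subset_rIoo {a b : EReal} {x : ℝ} (hx : (x : EReal) < b) : rIoc a x ⊆ rIoo a b :=
  fun _ hz => ⟨hz.1, hz.2.trans_lt hx⟩

theorem rIoo_subset_rIoc {a : EReal} {x : ℝ} : rIoo a x ⊆ rIoc a x :=
  fun _ hz => ⟨hz.1, hz.2.le⟩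

theorem qnorm_rIoo_eq_iSup {p : ℝ≥0∞} (hp : 0 < p) (f : ℝ → ℝ≥0∞) (a b : EReal) (μ : Measure ℝ) :
    qnorm f p (rIoo a b) μ = ⨆ (x : ℝ) (_ : x ∈ rIoo a b), qnorm f p (rIoc a x) μ := by
  refine le_antisymm ?_ (iSup₂_le fun x hx => qnorm_mono_set (rIoc_subset_rIoo hx.2))
  refine qnorm_le_of_ae_Iic hp (measurableSet_rIoo a b) ?_
  filter_upwards [ae_restrict_mem (measurableSet_rIoo a b)] with x hx
  refine le_iSup₂_of_le x hx (qnorm_mono_set fun y hy => ⟨hy.1.1, EReal.coe_le_coe_iff.2 hy.2⟩)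

theorem leftSup_qnorm {p : ℝ≥0∞} (hp : 0 < p) (f : ℝ → ℝ≥0∞) {a b : EReal} (μ : Measure ℝ) {x : ℝ}
    (hx : x ∈ rIoo a b) :
    leftSup a b (fun x => qnorm f p (rIoc a x) μ) x = qnorm f p (rIoo a x) μ := by
  rw [qnorm_rIoo_eq_iSup hp, leftSup]
  refine le_antisymm ?_ ?_
  · exact iSup_le fun y => iSup_le fun hy => iSup_le fun hyx =>
      le_iSup₂_of_le y ⟨hy.1, EReal.coe_lt_coe_iff.2 hyx⟩ le_rfl
  · exact iSup_le fun y => iSup_le fun hy =>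
      le_iSup₂_of_le y ⟨hy.1, hy.2.trans hx.2⟩ (le_iSup_of_le (EReal.coe_lt_coe_iff.1 hy.2) le_rfl)

/-! ### Left limits of tail suprema -/

/-- The tail supremum `‖g‖_{∞,(x,b),μ}`. -/
noncomputable def tailSup (b : EReal) (g : ℝ → ℝ≥0∞) (μ : Measure ℝ) (x : ℝ) : ℝ≥0∞ :=
  qnorm g ∞ (rIoo x b) μ

/-- The left limit of the tail supremum, computed within `(a, ∞)`. -/
noncomputable def tailSupLeft (a b : EReal) (g : ℝ → ℝ≥0∞) (μ : Measure ℝ) (x : ℝ) : ℝ≥0∞ :=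
  ⨅ (y : ℝ) (_ : a < (y : EReal)) (_ : y < x), tailSup b g μ y

theorem tailSup_antitone (b : EReal) (g : ℝ → ℝ≥0∞) (μ : Measure ℝ) : Antitone (tailSup b g μ) :=
  fun _ _ h => qnorm_mono_set fun _ hz => ⟨(EReal.coe_le_coe_iff.2 h).trans_lt hz.1, hz.2⟩

theorem tailSupLeft_antitone (a b : EReal) (g : ℝ → ℝ≥0∞) (μ : Measure ℝ) :
    Antitone (tailSupLeft a b g μ) :=
  fun _ _ h => le_iInf fun y => le_iInf fun hy => le_iInf fun hyx =>
    iInf₂_le_of_le y hy (iInf_le_of_le (hyx.trans_le h) le_rfl)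

theorem tailSupLeft_le {a b : EReal} {g : ℝ → ℝ≥0∞} {μ : Measure ℝ} {x y : ℝ} (hy : a < (y : EReal))
    (hyx : y < x) : tailSupLeft a b g μ x ≤ tailSup b g μ y :=
  iInf₂_le_of_le y hy (iInf_le_of_le hyx le_rfl)

/-- It suffices to use the countably many rational left end points, so `μ` may be arbitrary. -/
theorem ae_le_tailSupLeft (a b : EReal) (g : ℝ → ℝ≥0∞) (μ : Measure ℝ) :
    ∀ᵐ x ∂(μ.restrict (rIoo a b)), g x ≤ tailSupLeft a b g μ x := by
  have h : ∀ q : ℚ, ∀ᵐ x ∂(μ.restrict (rIoo a b)), (q : ℝ) < x → g x ≤ tailSup b g μ q := by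
    intro q
    have h1 : ∀ᵐ x ∂μ, x ∈ rIoo (q : ℝ) b → g x ≤ tailSup b g μ q :=
      (ae_restrict_iff' (measurableSet_rIoo _ _)).1 (ae_le_qnorm_top g _ μ)
    rw [ae_restrict_iff' (measurableSet_rIoo _ _)]
    filter_upwards [h1] with x hx hxI hqx
    exact hx ⟨EReal.coe_lt_coe_iff.2 hqx, hxI.2⟩
  filter_upwards [ae_all_iff.2 h] with x hx
  refine le_iInf fun y => le_iInf fun _ => le_iInf fun hyx => ?_
  obtain ⟨q, hq1, hq2⟩ := exists_rat_btwn hyx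
  exact (hx q hq2).trans (tailSup_antitone b g μ hq1.le)

/-! ### The best constant -/

/-- A two-sided estimate of the admissible constants gives the criterion and the equivalence. -/
theorem bestConst_equiv {p q : ℝ≥0∞} {a b : EReal} {μ ν : Measure ℝ} {u w : ℝ → ℝ≥0∞}
    {A : ℝ≥0∞} {C : ℝ≥0} (hC : 0 < C)
    (h1 : ∀ c : ℝ≥0, ReverseHardy p q a b μ ν u w c → A ≤ C * c)
    (h2 : ∀ c : ℝ≥0, C * A ≤ c → ReverseHardy p q a b μ ν u w c) :
    ((∃ c : ℝ≥0, ReverseHardy p q a b μ ν u w c) ↔ A < ∞) ∧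
      EquivWith C (bestConst p q a b μ ν u w) A := by
  have hC0 : (C : ℝ≥0∞) ≠ 0 := by exact_mod_cast hC.ne'
  refine ⟨⟨fun ⟨c, hc⟩ => (h1 c hc).trans_lt (by finiteness), fun hA => ?_⟩, ?_, ?_⟩
  · exact ⟨(C * A).toNNReal, h2 _ (by rw [ENNReal.coe_toNNReal (by finiteness)])⟩
  · rcases eq_or_ne A ∞ with rfl | hA
    · rw [ENNReal.mul_top hC0]; exact le_top
    · have := h2 (C * A).toNNReal (by rw [ENNReal.coe_toNNReal (by finiteness)])
      refine (iInf₂_le _ this).trans ?_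
      rw [ENNReal.coe_toNNReal (by finiteness)]
  · rw [bestConst, ENNReal.mul_iInf_of_ne hC0 (by finiteness)]
    refine le_iInf fun c => ?_
    by_cases hc : ReverseHardy p q a b μ ν u w c
    · simpa [hc] using h1 c hc
    · simp [hc, hC.ne']

/-- Testing with the characteristic function of `(a, x]`. -/
theorem qnorm_rIoc_le_of_reverseHardy {p q : ℝ≥0∞} {a b : EReal} {μ ν : Measure ℝ} {u w : ℝ → ℝ≥0∞}
    {c : ℝ≥0} (h : ReverseHardy p q a b μ ν u w c) {x : ℝ} (hx : x ∈ rIoo a b) :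
    qnorm w p (rIoc a x) μ ≤ c * qnorm u q (rIoo a x) ν := by
  have hI := measurableSet_rIoc a x
  have h1 := h ((rIoc a x).indicator 1) (measurable_one.indicator hI)
  have h2 : (fun y => (rIoc a x).indicator (1 : ℝ → ℝ≥0∞) y * w y) = (rIoc a x).indicator w := by
    ext y
    by_cases hy : y ∈ rIoc a x <;> simp [hy]
  rw [h2, qnorm_indicator hI, inter_eq_left.2 (rIoc_subset_rIoo hx.2)] at h1
  refine h1.trans ?_
  gcongr
  calc qnorm (fun y => u y * qnorm ((rIoc a x).indicator 1) ∞ (rIoo y b) μ) q (rIoo a b) ν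
      ≤ qnorm ((rIoo a x).indicator u) q (rIoo a b) ν := by
        refine qnorm_mono_ae ?_
        filter_upwards [ae_restrict_mem (measurableSet_rIoo a b)] with y hy
        by_cases hyx : y < x
        · rw [indicator_of_mem (show y ∈ rIoo a x from ⟨hy.1, EReal.coe_lt_coe_iff.2 hyx⟩)]
          refine mul_le_of_le_one_right zero_le (qnorm_top_le (ae_of_all _ fun z => ?_))
          exact indicator_le_self' (fun _ _ => zero_le) z
        · have : qnorm ((rIoc a x).indicator 1) ∞ (rIoo y b) μ = 0 := by
            refine le_antisymm (qnorm_top_le ?_) zero_le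
            filter_upwards [ae_restrict_mem (measurableSet_rIoo y b)] with z hz
            rw [indicator_of_notMem]
            intro hzx
            exact hyx (EReal.coe_lt_coe_iff.1 (hz.1.trans_le hzx.2))
          rw [this, mul_zero]
          exact zero_le
    _ = qnorm u q (rIoo a x) ν := by
        rw [qnorm_indicator (measurableSet_rIoo a x), inter_eq_left.2]
        exact fun z hz => ⟨hz.1, hz.2.trans hx.2⟩

/-! ### The case `q ≤ p` -/

theorem A₁_le {p q : ℝ≥0∞} {a b : EReal} {μ ν : Measure ℝ} {u w : ℝ → ℝ≥0∞}
    {c : ℝ≥0} (h : ReverseHardy p q a b μ ν u w c) : A₁ p q a b μ ν u w ≤ c := by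
  refine qnorm_top_le ?_
  filter_upwards [ae_restrict_mem (measurableSet_rIoo a b)] with x hx
  exact ENNReal.div_le_of_le_mul (qnorm_rIoc_le_of_reverseHardy h hx)

/-- If `‖u‖_{q,(a,x),ν} = 0`, finiteness of `A₁` forces `‖w‖_{p,(a,x],μ} = 0`. -/
theorem ae_le_A₁_mul {p q : ℝ≥0∞} {a b : EReal} {μ ν : Measure ℝ} {u w : ℝ → ℝ≥0∞}
    (hu : ∀ t ∈ rIoo a b, qnorm u q (rIoc a (t : EReal)) ν < ∞) (hA : A₁ p q a b μ ν u w ≠ ∞) :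
    ∀ᵐ x : ℝ ∂(μ.restrict (rIoo a b)),
      qnorm w p (rIoc a x) μ ≤ A₁ p q a b μ ν u w * qnorm u q (rIoo a x) ν := by
  filter_upwards [ae_le_qnorm_top _ (rIoo a b) μ, ae_restrict_mem (measurableSet_rIoo a b)]
    with x hx hxI
  change qnorm w p (rIoc a (x : EReal)) μ * (qnorm u q (rIoo a (x : EReal)) ν)⁻¹ ≤
    A₁ p q a b μ ν u w at hx
  have hfin : qnorm u q (rIoo a x) ν ≠ ∞ :=
    ((qnorm_mono_set rIoo_subset_rIoc).trans_lt (hu x hxI)).ne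
  rcases eq_or_ne (qnorm u q (rIoo a x) ν) 0 with h0 | h0
  · rw [h0, ENNReal.inv_zero] at hx
    by_cases hw : qnorm w p (rIoc a x) μ = 0
    · rw [hw]; exact zero_le
    · rw [ENNReal.mul_top hw, top_le_iff] at hx
      exact absurd hx hA
  · rwa [← div_eq_mul_inv, ENNReal.div_le_iff h0 hfin] at hx

/-- The superlevel sets of `tailSupLeft` and `tailSup` are initial segments; the second contains
every point to the left of a point of the first. -/
theorem qnorm_superlevel_le {p q : ℝ≥0∞} (hp : 0 < p) {a b : EReal} {μ ν : Measure ℝ}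
    {u w : ℝ → ℝ≥0∞}
    (hu : ∀ t ∈ rIoo a b, qnorm u q (rIoc a (t : EReal)) ν < ∞) (hA : A₁ p q a b μ ν u w ≠ ∞)
    (g : ℝ → ℝ≥0∞) (t : ℝ≥0∞) :
    qnorm w p ({x | t < tailSupLeft a b g μ x} ∩ rIoo a b) μ ≤
      A₁ p q a b μ ν u w * qnorm u q ({x | t < tailSup b g μ x} ∩ rIoo a b) ν := by
  have hm : MeasurableSet ({x | t < tailSupLeft a b g μ x} ∩ rIoo a b) :=
    (measurableSet_lt measurable_const (tailSupLeft_antitone a b g μ).measurable).inter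
      (measurableSet_rIoo a b)
  refine qnorm_le_of_ae_Iic hp hm ?_
  filter_upwards [ae_restrict_mem hm,
    ae_restrict_of_ae_restrict_of_subset inter_subset_right (ae_le_A₁_mul hu hA)] with x hx hxA
  calc qnorm w p ({x | t < tailSupLeft a b g μ x} ∩ rIoo a b ∩ Iic x) μ
      ≤ qnorm w p (rIoc a x) μ :=
        qnorm_mono_set fun y hy => ⟨hy.1.2.1, EReal.coe_le_coe_iff.2 hy.2⟩
    _ ≤ _ := hxA
    _ ≤ _ := by
        gcongr
        refine qnorm_mono_set fun y hy => ⟨?_, hy.1, hy.2.trans hx.2.2⟩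
        exact lt_of_lt_of_le hx.1 (tailSupLeft_le hy.1 (EReal.coe_lt_coe_iff.1 hy.2))

theorem qnorm_mul_le_tailSupLeft {p : ℝ≥0∞} {a b : EReal} {μ : Measure ℝ} (g w : ℝ → ℝ≥0∞) :
    qnorm (fun x => g x * w x) p (rIoo a b) μ ≤
      qnorm (fun x => w x * tailSupLeft a b g μ x) p (rIoo a b) μ := by
  refine qnorm_mono_ae ?_
  filter_upwards [ae_le_tailSupLeft a b g μ] with x hx
  rw [mul_comm]
  gcongr

theorem reverseHardy_of_A₁_of_lt_top {p q : ℝ≥0∞} (hq : 0 < q) (hqp : q ≤ p) (hp' : p < ∞)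
    {a b : EReal} {μ ν : Measure ℝ} {u w : ℝ → ℝ≥0∞} (hum : Measurable u) (hwm : Measurable w)
    (hu : ∀ t ∈ rIoo a b, qnorm u q (rIoc a (t : EReal)) ν < ∞) (hA : A₁ p q a b μ ν u w ≠ ∞)
    {g : ℝ → ℝ≥0∞} :
    qnorm (fun x => g x * w x) p (rIoo a b) μ ≤
      2 * geomConst q.toReal ^ (1 / q.toReal) * A₁ p q a b μ ν u w *
        qnorm (fun x => u x * qnorm g ∞ (rIoo x b) μ) q (rIoo a b) ν := by
  have hp : 0 < p := hq.trans_le hqp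
  have hq' : q < ∞ := hqp.trans_lt hp'
  have hP := ENNReal.toReal_pos hp.ne' hp'.ne
  have hQ := ENNReal.toReal_pos hq.ne' hq'.ne
  set P := p.toReal
  set Q := q.toReal
  have hPQ : 1 ≤ P / Q := (one_le_div hQ).2 (ENNReal.toReal_mono hp'.ne hqp)
  set A := A₁ p q a b μ ν u w
  have hG := (tailSup_antitone b g μ).measurable
  have hΓ := (tailSupLeft_antitone a b g μ).measurable
  refine (qnorm_mul_le_tailSupLeft g w).trans ?_
  rw [← ENNReal.rpow_le_rpow_iff hP, qnorm_mul_rpow hp hp' hwm hΓ]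
  set N := qnorm (fun x => u x * qnorm g ∞ (rIoo x b) μ) q (rIoo a b) ν
  have hN : ∫⁻ x, tailSup b g μ x ^ Q ∂(powMeasure u Q (rIoo a b) ν) = N ^ Q :=
    (qnorm_mul_rpow hq hq' hum hG (rIoo a b) ν).symm
  calc ∫⁻ x, tailSupLeft a b g μ x ^ P ∂(powMeasure w P (rIoo a b) μ)
      ≤ 2 ^ P * ∑' k : ℤ, 2 ^ ((k : ℝ) * P) * powMeasure w P (rIoo a b) μ
          {x | (2 : ℝ≥0∞) ^ (k : ℝ) < tailSupLeft a b g μ x} := lintegral_rpow_le_layer _ hΓ hP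
    _ ≤ 2 ^ P * ∑' k : ℤ, A ^ P * (2 ^ ((k : ℝ) * Q) * powMeasure u Q (rIoo a b) ν
          {x | (2 : ℝ≥0∞) ^ (k : ℝ) < tailSup b g μ x}) ^ (P / Q) := by
        refine mul_le_mul_right (ENNReal.tsum_le_tsum fun k => ?_) _
        rw [powMeasure_apply hp hp' w μ (measurableSet_lt measurable_const hΓ),
          powMeasure_apply hq hq' u ν (measurableSet_lt measurable_const hG),
          ENNReal.mul_rpow_of_nonneg _ _ (by positivity), ← ENNReal.rpow_mul, ← ENNReal.rpow_mul,
          mul_assoc (k : ℝ), mul_div_cancel₀ P hQ.ne', mul_left_comm,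
          ← ENNReal.mul_rpow_of_nonneg _ _ hP.le]
        gcongr
        exact qnorm_superlevel_le hp hu hA g _
    _ ≤ 2 ^ P * (A ^ P * (geomConst Q * N ^ Q) ^ (P / Q)) := by
        rw [ENNReal.tsum_mul_left]
        gcongr
        refine (tsum_rpow_le_rpow_tsum _ hPQ).trans ?_
        gcongr
        rw [← hN]
        exact layer_le_lintegral_rpow _ hG hQ
    _ = _ := by
        rw [ENNReal.mul_rpow_of_nonneg _ _ (by positivity), ← ENNReal.rpow_mul,
          mul_div_cancel₀ P hQ.ne', ENNReal.mul_rpow_of_nonneg _ _ hP.le,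
          ENNReal.mul_rpow_of_nonneg _ _ hP.le, ENNReal.mul_rpow_of_nonneg _ _ hP.le,
          ← ENNReal.rpow_mul, one_div_mul_eq_div]
        ring

theorem reverseHardy_of_A₁_top {q : ℝ≥0∞} (hq : 0 < q)
    {a b : EReal} {μ ν : Measure ℝ} {u w : ℝ → ℝ≥0∞} (hum : Measurable u)
    (hu : ∀ t ∈ rIoo a b, qnorm u q (rIoc a (t : EReal)) ν < ∞) (hA : A₁ ∞ q a b μ ν u w ≠ ∞)
    {g : ℝ → ℝ≥0∞} :
    qnorm (fun x => g x * w x) ∞ (rIoo a b) μ ≤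
      2 * A₁ ∞ q a b μ ν u w *
        qnorm (fun x => u x * qnorm g ∞ (rIoo x b) μ) q (rIoo a b) ν := by
  refine (qnorm_mul_le_tailSupLeft g w).trans (qnorm_top_le ?_)
  set N := qnorm (fun x => u x * qnorm g ∞ (rIoo x b) μ) q (rIoo a b) ν
  set A := A₁ ∞ q a b μ ν u w
  have hG := (tailSup_antitone b g μ).measurable
  have hΓ := (tailSupLeft_antitone a b g μ).measurable
  have h : ∀ k : ℤ, ∀ᵐ x ∂(μ.restrict (rIoo a b)),
      (2 : ℝ≥0∞) ^ (k : ℝ) < tailSupLeft a b g μ x → 2 ^ (k : ℝ) * w x ≤ A * N := by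
    intro k
    have hm : MeasurableSet {x | (2 : ℝ≥0∞) ^ (k : ℝ) < tailSupLeft a b g μ x} :=
      measurableSet_lt measurable_const hΓ
    have h1 : 2 ^ (k : ℝ) * qnorm u q ({x | (2 : ℝ≥0∞) ^ (k : ℝ) < tailSup b g μ x} ∩ rIoo a b) ν
        ≤ N := by
      rw [← qnorm_const_mul hq hum, ← qnorm_indicator
        (measurableSet_lt measurable_const hG)]
      refine qnorm_mono_ae (ae_of_all _ fun x => ?_)
      by_cases hx : (2 : ℝ≥0∞) ^ (k : ℝ) < tailSup b g μ x
      · rw [indicator_of_mem (by exact hx), mul_comm]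
        gcongr
        exact hx.le
      · rw [indicator_of_notMem (by exact hx)]
        exact zero_le
    have h2 := ae_le_qnorm_top w ({x | (2 : ℝ≥0∞) ^ (k : ℝ) < tailSupLeft a b g μ x} ∩ rIoo a b) μ
    rw [← Measure.restrict_restrict hm, ae_restrict_iff' hm] at h2
    filter_upwards [h2] with x hx hxk
    calc 2 ^ (k : ℝ) * w x ≤ 2 ^ (k : ℝ) * (A * qnorm u q
          ({x | (2 : ℝ≥0∞) ^ (k : ℝ) < tailSup b g μ x} ∩ rIoo a b) ν) := by
          gcongr
          exact (hx hxk).trans (qnorm_superlevel_le (by simp) hu hA g _)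
      _ ≤ A * N := by rw [mul_left_comm]; gcongr
  filter_upwards [ae_all_iff.2 h] with x hx
  rcases eq_or_ne (tailSupLeft a b g μ x) 0 with h0 | h0
  · rw [h0, mul_zero]; exact zero_le
  rcases eq_or_ne (tailSupLeft a b g μ x) ∞ with ht | ht
  · rw [ht] at hx ⊢
    rcases eq_or_ne (w x) 0 with hw | hw
    · rw [hw, zero_mul]; exact zero_le
    -- All dyadic multiples of `w x` stay below `A * N`.
    have hAN : A * N = ∞ := by
      by_contra hne
      obtain ⟨k, hk⟩ := exists_lt_two_rpow (s := 1) one_pos (ENNReal.div_ne_top hne hw)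
      rw [mul_one] at hk
      have h3 := hx k (two_rpow_ne_top _).lt_top
      rw [← ENNReal.le_div_iff_mul_le (Or.inl hw) (Or.inr hne)] at h3
      exact (hk.trans_le h3).false
    rw [mul_assoc, hAN]
    simp
  · obtain ⟨k, hk1, hk2⟩ := exists_two_rpow_lt_le h0 ht
    calc w x * tailSupLeft a b g μ x ≤ w x * 2 ^ ((k : ℝ) + 1) := by gcongr
      _ = 2 * (2 ^ (k : ℝ) * w x) := by rw [two_rpow_add, ENNReal.rpow_one]; ring
      _ ≤ 2 * A * N := by rw [mul_assoc]; exact mul_le_mul_right (hx k hk1) _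

theorem exists_equiv_A₁ (p q : ℝ≥0∞) (hq : 0 < q) (hqp : q ≤ p) :
    ∃ C : ℝ≥0, 0 < C ∧
      ∀ (a b : EReal) (μ ν : Measure ℝ) (u w : ℝ → ℝ≥0∞), Measurable u → Measurable w →
        (∀ t ∈ rIoo a b, qnorm u q (rIoc a (t : EReal)) ν < ∞) →
        ((∃ c : ℝ≥0, ReverseHardy p q a b μ ν u w c) ↔ A₁ p q a b μ ν u w < ∞) ∧
          EquivWith C (bestConst p q a b μ ν u w) (A₁ p q a b μ ν u w) := by
  have key : ∃ C : ℝ≥0, 1 ≤ C ∧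
      ∀ (a b : EReal) (μ ν : Measure ℝ) (u w : ℝ → ℝ≥0∞), Measurable u → Measurable w →
        (∀ t ∈ rIoo a b, qnorm u q (rIoc a (t : EReal)) ν < ∞) → A₁ p q a b μ ν u w ≠ ∞ →
        ∀ g : ℝ → ℝ≥0∞, qnorm (fun x => g x * w x) p (rIoo a b) μ ≤
          C * A₁ p q a b μ ν u w *
            qnorm (fun x => u x * qnorm g ∞ (rIoo x b) μ) q (rIoo a b) ν := by
    rcases eq_or_ne p ∞ with rfl | hp
    · refine ⟨2, by norm_num, fun a b μ ν u w hum _ hu hA g => ?_⟩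
      exact reverseHardy_of_A₁_top hq hum hu hA
    · have hq' : q ≠ ∞ := (hqp.trans_lt hp.lt_top).ne
      have hQ := ENNReal.toReal_pos hq.ne' hq'
      have hK : 2 * geomConst q.toReal ^ (1 / q.toReal) ≠ ∞ :=
        ENNReal.mul_ne_top (by norm_num)
          (ENNReal.rpow_ne_top_of_nonneg (by positivity) (geomConst_ne_top hQ))
      refine ⟨(2 * geomConst q.toReal ^ (1 / q.toReal)).toNNReal, ?_,
        fun a b μ ν u w hum hwm hu hA g => ?_⟩
      · rw [← ENNReal.coe_le_coe, ENNReal.coe_toNNReal hK, ENNReal.coe_one]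
        calc (1 : ℝ≥0∞) = 1 * 1 ^ (1 / q.toReal) := by simp
          _ ≤ _ := by
            gcongr
            · norm_num
            · exact one_le_geomConst _
      · rw [ENNReal.coe_toNNReal hK]
        exact reverseHardy_of_A₁_of_lt_top hq hqp hp.lt_top hum hwm hu hA
  obtain ⟨C, hC, h⟩ := key
  refine ⟨C, by positivity, fun a b μ ν u w hum hwm hu => ?_⟩
  refine bestConst_equiv (by positivity) (fun c hc => ?_) (fun c hc g _ => ?_)
  · refine (A₁_le hc).trans (le_mul_of_one_le_left zero_le ?_)
    exact_mod_cast hC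
  · have hA : A₁ p q a b μ ν u w ≠ ∞ := by
      intro htop
      rw [htop, ENNReal.mul_top (by exact_mod_cast (zero_lt_one.trans_le hC).ne'), top_le_iff] at hc
      exact ENNReal.coe_ne_top hc
    exact (h a b μ ν u w hum hwm hu hA g).trans (by gcongr)

/-! ### Stieltjes integrals as level sums -/

/-- Both the Stieltjes integral with its boundary term and the sum over the levels of `V` are
equivalent to the sum over the layers of `W`. -/
theorem exists_levelSum_equiv {r : ℝ} (hr : 0 < r) :
    ∃ C : ℝ≥0, 0 < C ∧ ∀ (a b : EReal) (V W : ℝ → ℝ≥0∞) (Wb Vb : ℝ≥0∞), Monotone V → Monotone W →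
      Wb = ⨆ (x : ℝ) (_ : x ∈ rIoo a b), W x → Vb = ⨆ (x : ℝ) (_ : x ∈ rIoo a b), V x →
      EquivWith C (levelSum a b V W r ^ (1 / r))
        (lsIntegral a b (fun x => W x ^ r) (negPow V r) ^ (1 / r) + Wb * Vb⁻¹) := by
  set K : ℝ≥0∞ := 2 ^ r * geomConst r * (2 ^ r + geomConst r) with hK
  have hg := geomConst_ne_top hr
  have h2 := two_rpow_ne_top r
  have hKtop : K ≠ ∞ := by finiteness
  have hK1 : 1 ≤ K := by
    have h1 : (1 : ℝ≥0∞) ≤ 2 ^ r := ENNReal.one_le_rpow (by norm_num) hr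
    calc (1 : ℝ≥0∞) = 1 * 1 * (1 + 0) := by simp
      _ ≤ K := by
        rw [hK]
        gcongr
        · exact one_le_geomConst r
        · exact zero_le
  have hr' : 0 ≤ 1 / r := by positivity
  have hCtop : 2 * (2 * K) ^ (1 / r) ≠ ∞ :=
    ENNReal.mul_ne_top (by norm_num) (ENNReal.rpow_ne_top_of_nonneg hr' (by finiteness))
  refine ⟨(2 * (2 * K) ^ (1 / r)).toNNReal, ENNReal.toNNReal_pos ?_ hCtop,
    fun a b V W Wb Vb hV hW hWb hVb => ?_⟩
  · refine mul_ne_zero (by norm_num) (ENNReal.rpow_pos ?_ (by finiteness)).ne'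
    exact pos_of_ne_zero (mul_ne_zero (by norm_num) (zero_lt_one.trans_le hK1).ne')
  rw [EquivWith, ENNReal.coe_toNNReal hCtop]
  set D := levelSum a b V W r
  set S := ∑' k : ℤ, 2 ^ ((k : ℝ) * r) * layerSup a b V W r k
  set L := lsIntegral a b (fun x => W x ^ r) (negPow V r)
  set X := Wb * Vb⁻¹
  have h1 : D ≤ 2 ^ r * geomConst r * S := levelSum_le_layerSup hr
  have h3 : S ≤ 2 ^ r * geomConst r * D := layerSup_le_levelSum hr
  have h4 : X ^ r ≤ 2 ^ r * S := sup_mul_inv_rpow_le_layerSup hr hWb hVb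
  have h5 : L ≤ 2 ^ r * S := lsIntegral_le_layerSup hr hV hW
  have h6 : S ≤ geomConst r * (L + X ^ r) := layerSup_le_lsIntegral hr hV hW hWb hVb
  have hDK : D ≤ K * (L + X ^ r) := by
    calc D ≤ 2 ^ r * geomConst r * (geomConst r * (L + X ^ r)) := h1.trans (by gcongr)
      _ ≤ 2 ^ r * geomConst r * ((2 ^ r + geomConst r) * (L + X ^ r)) := by
          gcongr; exact le_add_self
      _ = _ := by rw [hK]; ring
  have hSK : 2 ^ r * S ≤ K * D := by
    calc 2 ^ r * S ≤ 2 ^ r * (2 ^ r * geomConst r * D) := by gcongr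
      _ = 2 ^ r * geomConst r * 2 ^ r * D := by ring
      _ ≤ K * D := by rw [hK]; gcongr; exact le_self_add
  have hcancel : ∀ x : ℝ≥0∞, (x ^ (1 / r)) ^ r = x := fun x => by
    rw [← ENNReal.rpow_mul, one_div_mul_cancel hr.ne', ENNReal.rpow_one]
  have hcancel' : ∀ x : ℝ≥0∞, (x ^ r) ^ (1 / r) = x := fun x => by
    rw [← ENNReal.rpow_mul, mul_one_div_cancel hr.ne', ENNReal.rpow_one]
  constructor
  · have hLX : L + X ^ r ≤ 2 * (L ^ (1 / r) + X) ^ r := by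
      rw [two_mul]
      refine add_le_add ?_ (ENNReal.rpow_le_rpow le_add_self hr.le)
      calc L = (L ^ (1 / r)) ^ r := (hcancel L).symm
        _ ≤ _ := ENNReal.rpow_le_rpow le_self_add hr.le
    calc D ^ (1 / r) ≤ (2 * K * (L ^ (1 / r) + X) ^ r) ^ (1 / r) := by
          gcongr
          refine hDK.trans ((mul_le_mul_right hLX _).trans (le_of_eq ?_))
          ring
      _ = (2 * K) ^ (1 / r) * (L ^ (1 / r) + X) := by
          rw [ENNReal.mul_rpow_of_nonneg _ _ hr', hcancel']
      _ ≤ _ := by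
          gcongr
          exact le_mul_of_one_le_left zero_le (by norm_num)
  · have hmono : ∀ x : ℝ≥0∞, x ≤ 2 ^ r * S → x ^ (1 / r) ≤ (2 * K) ^ (1 / r) * D ^ (1 / r) := by
      intro x hx
      rw [← ENNReal.mul_rpow_of_nonneg _ _ hr']
      gcongr
      refine (hx.trans hSK).trans ?_
      gcongr
      exact le_mul_of_one_le_left zero_le (by norm_num)
    calc L ^ (1 / r) + X ≤ (2 * K) ^ (1 / r) * D ^ (1 / r) + (2 * K) ^ (1 / r) * D ^ (1 / r) := by
          refine add_le_add (hmono L h5) ?_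
          rw [← hcancel' X]
          exact hmono _ h4
      _ = _ := by ring

/-! ### Level sets of the weight norm -/

theorem qnorm_rIoo_monotone (f : ℝ → ℝ≥0∞) (p : ℝ≥0∞) (a : EReal) (μ : Measure ℝ) :
    Monotone (fun x : ℝ => qnorm f p (rIoo a x) μ) :=
  fun _ _ h => qnorm_mono_set fun _ hz => ⟨hz.1, hz.2.trans_le (EReal.coe_le_coe_iff.2 h)⟩

/-- The initial segment on which `‖u‖_{q,(a,x),ν} < t`. -/
def levelSet (q : ℝ≥0∞) (a : EReal) (ν : Measure ℝ) (u : ℝ → ℝ≥0∞) (t : ℝ≥0∞) : Set ℝ :=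
  {x | qnorm u q (rIoo a x) ν < t}

theorem measurableSet_levelSet (q : ℝ≥0∞) (a : EReal) (ν : Measure ℝ) (u : ℝ → ℝ≥0∞) (t : ℝ≥0∞) :
    MeasurableSet (levelSet q a ν u t) :=
  measurableSet_lt (qnorm_rIoo_monotone u q a ν).measurable measurable_const

theorem levelSup_eq_qnorm {p q : ℝ≥0∞} (hp : 0 < p) (hq : 0 < q) (a b : EReal) (μ ν : Measure ℝ)
    (u w : ℝ → ℝ≥0∞) (j : ℤ) :
    levelSup a b (fun x => qnorm u q (rIoc a x) ν) (fun x => qnorm w p (rIoc a x) μ) j =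
      qnorm w p (levelSet q a ν u (2 ^ (j : ℝ)) ∩ rIoo a b) μ := by
  refine le_antisymm ?_ ?_
  · refine iSup_le fun x => iSup_le fun hx => iSup_le fun hxj => ?_
    rw [leftSup_qnorm hq u ν hx] at hxj
    refine qnorm_mono_set fun y hy => ⟨?_, hy.1, hy.2.trans_lt hx.2⟩
    exact (qnorm_rIoo_monotone u q a ν (EReal.coe_le_coe_iff.1 hy.2)).trans_lt hxj
  · have hm := (measurableSet_levelSet q a ν u (2 ^ (j : ℝ))).inter (measurableSet_rIoo a b)
    refine qnorm_le_of_ae_Iic hp hm ?_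
    filter_upwards [ae_restrict_mem hm] with x hx
    refine le_iSup₂_of_le x hx.2 (le_iSup_of_le ?_ (qnorm_mono_set fun y hy =>
      ⟨hy.1.2.1, EReal.coe_le_coe_iff.2 hy.2⟩))
    rw [leftSup_qnorm hq u ν hx.2]
    exact hx.1

theorem levelSum_eq_qnorm {p q : ℝ≥0∞} (hp : 0 < p) (hq : 0 < q) (a b : EReal) (μ ν : Measure ℝ)
    (u w : ℝ → ℝ≥0∞) (r : ℝ) :
    levelSum a b (fun x => qnorm u q (rIoc a x) ν) (fun x => qnorm w p (rIoc a x) μ) r =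
      ∑' j : ℤ, 2 ^ ((j : ℝ) * (-r)) *
        qnorm w p (levelSet q a ν u (2 ^ (j : ℝ)) ∩ rIoo a b) μ ^ r := by
  simp only [levelSum, levelSup_eq_qnorm hp hq]

theorem exists_A₂_equiv {p q : ℝ≥0∞} (hp : 0 < p) (hq : 0 < q) {r : ℝ} (hr : 0 < r) :
    ∃ C : ℝ≥0, 0 < C ∧ ∀ (a b : EReal) (μ ν : Measure ℝ) (u w : ℝ → ℝ≥0∞),
      EquivWith C ((∑' j : ℤ, 2 ^ ((j : ℝ) * (-r)) *
        qnorm w p (levelSet q a ν u (2 ^ (j : ℝ)) ∩ rIoo a b) μ ^ r) ^ (1 / r))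
        (A₂ p q r a b μ ν u w) := by
  obtain ⟨C, hC, h⟩ := exists_levelSum_equiv hr
  refine ⟨C, hC, fun a b μ ν u w => ?_⟩
  rw [← levelSum_eq_qnorm hp hq]
  exact h a b _ _ _ _ (qnorm_rIoc_monotone u q a ν) (qnorm_rIoc_monotone w p a μ)
    (qnorm_rIoo_eq_iSup hp w a b μ) (qnorm_rIoo_eq_iSup hq u a b ν)

/-- Here `V` is the right limit of `‖u‖_{∞,(a,x],ν}`, which has the same left limits as
the norm itself. -/
theorem exists_A₃'_equiv {p : ℝ≥0∞} (hp : 0 < p) (hp' : p < ∞) :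
    ∃ C : ℝ≥0, 0 < C ∧ ∀ (a b : EReal) (μ ν : Measure ℝ) (u w : ℝ → ℝ≥0∞),
      EquivWith C ((∑' j : ℤ, 2 ^ ((j : ℝ) * (-p.toReal)) *
        qnorm w p (levelSet ∞ a ν u (2 ^ (j : ℝ)) ∩ rIoo a b) μ ^ p.toReal) ^ (1 / p.toReal))
        (A₃' p a b μ ν u w) := by
  have hP := ENNReal.toReal_pos hp.ne' hp'.ne
  obtain ⟨C, hC, h⟩ := exists_levelSum_equiv hP
  refine ⟨C, hC, fun a b μ ν u w => ?_⟩
  have hU := qnorm_rIoc_monotone u ∞ a ν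
  have hle : ∀ x : ℝ, qnorm u ∞ (rIoc a x) ν ≤ supNormRight a ν u x :=
    fun x => hU.le_rightLim le_rfl
  have hge : ∀ x y : ℝ, x < y → supNormRight a ν u x ≤ qnorm u ∞ (rIoc a y) ν := fun x y hxy =>
    hU.rightLim_le hxy
  have hV : Monotone (supNormRight a ν u) := hU.rightLim
  have hleft : ∀ x ∈ rIoo a b, leftSup a b (supNormRight a ν u) x =
      leftSup a b (fun x => qnorm u ∞ (rIoc a x) ν) x := by
    intro x hx
    refine le_antisymm ?_ ?_
    · refine iSup_le fun y => iSup_le fun hy => iSup_le fun hyx => ?_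
      obtain ⟨z, hz1, hz2⟩ := exists_between hyx
      exact le_iSup₂_of_le z (rIoo_ordConnected hy hx hz1.le hz2.le)
        (le_iSup_of_le hz2 (hge y z hz1))
    · exact iSup_mono fun y => iSup_mono fun _ => iSup_mono fun _ => hle y
  have hsum : levelSum a b (supNormRight a ν u) (fun x => qnorm w p (rIoc a x) μ) p.toReal =
      levelSum a b (fun x => qnorm u ∞ (rIoc a x) ν) (fun x => qnorm w p (rIoc a x) μ)
        p.toReal := by
    refine tsum_congr fun j => ?_
    congr 2
    refine iSup_congr fun x => iSup_congr fun hx => ?_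
    rw [hleft x hx]
  have hsup : qnorm u ∞ (rIoo a b) ν = ⨆ (x : ℝ) (_ : x ∈ rIoo a b), supNormRight a ν u x := by
    rw [qnorm_rIoo_eq_iSup (by simp)]
    refine le_antisymm (iSup₂_mono fun (x : ℝ) _ => hle x) (iSup₂_le fun x hx => ?_)
    obtain ⟨y, hy, hyI⟩ := exists_gt_mem_rIoo hx
    exact le_iSup₂_of_le y hyI (hge x y hy)
  rw [← levelSum_eq_qnorm hp (by simp), ← hsum]
  exact h a b (supNormRight a ν u) (fun x => qnorm w p (rIoc a x) μ) _ _ hV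
    (qnorm_rIoc_monotone w p a μ) (qnorm_rIoo_eq_iSup hp w a b μ) hsup

/-- The right limit of `‖u‖_{q,(a,x),ν}` relative to `(a, b)`. -/
noncomputable def normRight (q : ℝ≥0∞) (a b : EReal) (ν : Measure ℝ) (u : ℝ → ℝ≥0∞) (y : ℝ) :
    ℝ≥0∞ :=
  ⨅ (x : ℝ) (_ : y < x) (_ : (x : EReal) < b), qnorm u q (rIoo a x) ν

theorem normRight_monotone (q : ℝ≥0∞) (a b : EReal) (ν : Measure ℝ) (u : ℝ → ℝ≥0∞) :
    Monotone (normRight q a b ν u) :=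
  fun _ _ h => le_iInf fun x => le_iInf fun hx => le_iInf fun hxb =>
    iInf₂_le_of_le x (h.trans_lt hx) (iInf_le_of_le hxb le_rfl)

/-- On the initial segment where `normRight < t` the norm of `u` is at most `t`. -/
theorem qnorm_normRight_lt_le {q : ℝ≥0∞} (hq : 0 < q) (a b : EReal) (ν : Measure ℝ)
    (u : ℝ → ℝ≥0∞) (t : ℝ≥0∞) : qnorm u q ({y | normRight q a b ν u y < t} ∩ rIoo a b) ν ≤ t := by
  have hm : MeasurableSet ({y | normRight q a b ν u y < t} ∩ rIoo a b) :=
    (measurableSet_lt (normRight_monotone q a b ν u).measurable measurable_const).inter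
      (measurableSet_rIoo a b)
  refine qnorm_le_of_ae_Iic hq hm ?_
  filter_upwards [ae_restrict_mem hm] with y hy
  have h := hy.1
  simp only [mem_ofPred_eq, normRight, iInf_lt_iff] at h
  obtain ⟨x, hyx, -, hx⟩ := h
  exact (qnorm_mono_set fun z hz => (⟨hz.1.2.1,
    EReal.coe_lt_coe_iff.2 (lt_of_le_of_lt hz.2 hyx)⟩ : z ∈ rIoo a x)).trans hx.le

/-! ### The case `p < q < ∞` -/

section Exponents

variable {P Q r : ℝ}

/-- The relations among the exponents; `Q / P` and `r / P` are the conjugate exponents for which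
the Hölder inequality is used. -/
theorem exponent_identities (hP : 0 < P) (hQ : 0 < Q) (hPQ : P < Q) (h : 1 / r = 1 / P - 1 / Q) :
    0 < r ∧ P < r ∧ (r - P) * (Q / P) = r ∧ -r * (Q / P) = -r - Q ∧
      (Q / P).HolderConjugate (r / P) := by
  have hr1 : 0 < 1 / r := by
    rw [h, sub_pos]
    exact one_div_lt_one_div_of_lt hP hPQ
  have hr : 0 < r := one_div_pos.1 hr1
  have h1 : P * Q = r * (Q - P) := by
    field_simp at h
    linarith
  have hPr : P < r := by
    have hQP : 0 < Q - P := sub_pos.2 hPQ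
    nlinarith
  refine ⟨hr, hPr, ?_, ?_, ?_⟩
  · field_simp; linarith
  · field_simp; linarith
  · rw [Real.holderConjugate_iff]
    refine ⟨(one_lt_div hP).2 hPQ, ?_⟩
    field_simp
    linarith

end Exponents

section

variable {p q : ℝ≥0∞} {r : ℝ} {a b : EReal} {μ ν : Measure ℝ} {u w : ℝ → ℝ≥0∞}

/-- Points with `‖u‖_{q,(a,x),ν} = 0` lie in all levels, and the weights `2 ^ (-j r)` of the
levels are unbounded. -/
theorem qnorm_zero_level_eq_zero (hr : 0 < r)
    (hD : ∑' j : ℤ, 2 ^ ((j : ℝ) * (-r)) *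
      qnorm w p (levelSet q a ν u (2 ^ (j : ℝ)) ∩ rIoo a b) μ ^ r ≠ ∞) :
    qnorm w p ({x | qnorm u q (rIoo a x) ν = 0} ∩ rIoo a b) μ = 0 := by
  set z := qnorm w p ({x | qnorm u q (rIoo a x) ν = 0} ∩ rIoo a b) μ
  by_contra hz
  have hzr : z ^ r ≠ 0 := fun h => hz ((ENNReal.rpow_eq_zero_iff_of_pos hr).1 h)
  obtain ⟨k, hk⟩ := exists_lt_two_rpow hr (ENNReal.div_ne_top hD hzr)
  refine (hk.trans_le ?_).false
  rw [ENNReal.le_div_iff_mul_le (Or.inl hzr) (Or.inr hD)]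
  calc 2 ^ ((k : ℝ) * r) * z ^ r ≤ 2 ^ (((-k : ℤ) : ℝ) * (-r)) *
        qnorm w p (levelSet q a ν u (2 ^ ((-k : ℤ) : ℝ)) ∩ rIoo a b) μ ^ r := by
        push_cast
        rw [neg_mul_neg]
        gcongr
        refine qnorm_mono_set (inter_subset_inter_left _ fun x hx => ?_)
        exact lt_of_eq_of_lt hx (pos_of_ne_zero (two_rpow_ne_zero _))
    _ ≤ _ := ENNReal.le_tsum (-k)

/-- The interval is split into the sets `2 ^ j ≤ ‖u‖_{q,(a,x),ν} < 2 ^ (j + 1)`. -/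
theorem lintegral_tailSupLeft_le (hp : 0 < p) (hp' : p < ∞)
    (hu : ∀ t ∈ rIoo a b, qnorm u q (rIoc a (t : EReal)) ν < ∞)
    (h0 : qnorm w p ({x | qnorm u q (rIoo a x) ν = 0} ∩ rIoo a b) μ = 0) (g : ℝ → ℝ≥0∞) :
    ∫⁻ x, tailSupLeft a b g μ x ^ p.toReal ∂(powMeasure w p.toReal (rIoo a b) μ) ≤
      ∑' j : ℤ, (⨆ (x : ℝ) (_ : x ∈ rIoo a b) (_ : (2 : ℝ≥0∞) ^ (j : ℝ) ≤ qnorm u q (rIoo a x) ν),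
          tailSupLeft a b g μ x) ^ p.toReal *
        qnorm w p (levelSet q a ν u (2 ^ ((j : ℝ) + 1)) ∩ rIoo a b) μ ^ p.toReal := by
  have hP := ENNReal.toReal_pos hp.ne' hp'.ne
  set P := p.toReal
  set γ : ℤ → ℝ≥0∞ := fun j => ⨆ (x : ℝ) (_ : x ∈ rIoo a b)
    (_ : (2 : ℝ≥0∞) ^ (j : ℝ) ≤ qnorm u q (rIoo a x) ν), tailSupLeft a b g μ x with hγ
  have hm := fun j : ℤ => measurableSet_levelSet q a ν u (2 ^ ((j : ℝ) + 1))
  have hnull : ∀ᵐ x : ℝ ∂(powMeasure w P (rIoo a b) μ), qnorm u q (rIoo a x) ν ≠ 0 := by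
    rw [ae_iff]
    simp only [not_not]
    rw [powMeasure_apply hp hp' w μ
      (measurableSet_eq_fun (qnorm_rIoo_monotone u q a ν).measurable measurable_const), h0,
      ENNReal.zero_rpow_of_pos hP]
  calc ∫⁻ x, tailSupLeft a b g μ x ^ P ∂(powMeasure w P (rIoo a b) μ)
      ≤ ∫⁻ x, ∑' j : ℤ, (levelSet q a ν u (2 ^ ((j : ℝ) + 1))).indicator (fun _ => γ j ^ P) x
          ∂(powMeasure w P (rIoo a b) μ) := by
        refine lintegral_mono_ae ?_
        filter_upwards [hnull, ae_powMeasure (ae_restrict_mem (measurableSet_rIoo a b))]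
          with x hx0 hxI
        have hxt : qnorm u q (rIoo a x) ν ≠ ∞ :=
          ((qnorm_mono_set rIoo_subset_rIoc).trans_lt (hu x hxI)).ne
        obtain ⟨j, hj1, hj2⟩ := exists_two_rpow_le_lt hx0 hxt
        refine le_trans ?_ (ENNReal.le_tsum j)
        rw [indicator_of_mem (show x ∈ levelSet q a ν u (2 ^ ((j : ℝ) + 1)) from hj2)]
        gcongr
        exact le_iSup₂_of_le x hxI (le_iSup_of_le hj1 le_rfl)
    _ = ∑' j : ℤ, γ j ^ P * powMeasure w P (rIoo a b) μ (levelSet q a ν u (2 ^ ((j : ℝ) + 1))) := by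
        rw [lintegral_tsum fun j => (measurable_const.indicator (hm j)).aemeasurable]
        refine tsum_congr fun j => ?_
        rw [lintegral_indicator (hm j), lintegral_const, Measure.restrict_apply_univ]
    _ = _ := by
        refine tsum_congr fun j => ?_
        rw [powMeasure_apply hp hp' w μ (hm j)]

/-- Sufficiency: the sum over the levels is split by the Hölder inequality; the factor that contains
`g` is compared with `∫ ‖g‖_{∞,(x,b),μ} ^ q u ^ q dν` by layering in `g`. -/
theorem reverseHardy_of_levelSum (hp : 0 < p) (hpq : p < q) (hq' : q < ∞)
    (hr : 1 / r = 1 / p.toReal - 1 / q.toReal) (hum : Measurable u) (hwm : Measurable w)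
    (hu : ∀ t ∈ rIoo a b, qnorm u q (rIoc a (t : EReal)) ν < ∞) {D : ℝ≥0∞}
    (hDdef : D = ∑' j : ℤ, 2 ^ ((j : ℝ) * (-r)) *
      qnorm w p (levelSet q a ν u (2 ^ (j : ℝ)) ∩ rIoo a b) μ ^ r) (hD : D ≠ ∞)
    (g : ℝ → ℝ≥0∞) :
    qnorm (fun x => g x * w x) p (rIoo a b) μ ≤
      2 * (2 ^ q.toReal * geomConst q.toReal * geomConst q.toReal) ^ (1 / q.toReal) *
        D ^ (1 / r) * qnorm (fun x => u x * qnorm g ∞ (rIoo x b) μ) q (rIoo a b) ν := by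
  have hp' : p < ∞ := hpq.trans hq'
  have hq : 0 < q := hp.trans hpq
  have hP := ENNReal.toReal_pos hp.ne' hp'.ne
  have hQ := ENNReal.toReal_pos hq.ne' hq'.ne
  have hPQ : p.toReal < q.toReal := ENNReal.toReal_strict_mono hq'.ne hpq
  obtain ⟨hr0, -, -, -, hconj⟩ := exponent_identities hP hQ hPQ hr
  set P := p.toReal
  set Q := q.toReal
  have hG := (tailSup_antitone b g μ).measurable
  have hΓ := (tailSupLeft_antitone a b g μ).measurable
  set N := qnorm (fun x => u x * qnorm g ∞ (rIoo x b) μ) q (rIoo a b) ν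
  have hN : ∫⁻ x, tailSup b g μ x ^ Q ∂(powMeasure u Q (rIoo a b) ν) = N ^ Q :=
    (qnorm_mul_rpow hq hq' hum hG (rIoo a b) ν).symm
  set K := 2 ^ Q * geomConst Q * geomConst Q with hK
  set γ : ℤ → ℝ≥0∞ := fun j => ⨆ (x : ℝ) (_ : x ∈ rIoo a b)
    (_ : (2 : ℝ≥0∞) ^ (j : ℝ) ≤ qnorm u q (rIoo a x) ν), tailSupLeft a b g μ x with hγ
  set ω : ℤ → ℝ≥0∞ := fun j => qnorm w p (levelSet q a ν u (2 ^ (j : ℝ)) ∩ rIoo a b) μ with hω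
  have hγsum : ∑' j : ℤ, 2 ^ ((j : ℝ) * Q) * γ j ^ Q ≤ K * N ^ Q := by
    have h1 := tsum_rpow_le_layer hQ hQ.ne' γ (fun k => powMeasure u Q (rIoo a b) ν
      {x | (2 : ℝ≥0∞) ^ (k : ℝ) < tailSup b g μ x}) ?_
    · refine h1.trans ?_
      rw [abs_of_pos hQ, hK, mul_assoc (2 ^ Q * geomConst Q), ← hN]
      exact mul_le_mul_right (layer_le_lintegral_rpow _ hG hQ) _
    · intro k j hkj
      simp only [hγ, lt_iSup_iff] at hkj
      obtain ⟨x, hx, hxj, hxk⟩ := hkj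
      rw [powMeasure_apply hq hq' u ν (measurableSet_lt measurable_const hG), ENNReal.rpow_mul]
      refine ENNReal.rpow_le_rpow (hxj.trans (qnorm_mono_set fun y hy => ?_)) hQ.le
      exact ⟨hxk.trans_le (tailSupLeft_le hy.1 (EReal.coe_lt_coe_iff.1 hy.2)),
        hy.1, hy.2.trans hx.2⟩
  have hωsum : ∑' j : ℤ, (2 ^ (-(j : ℝ)) * ω (j + 1)) ^ r = 2 ^ r * D := by
    have hshift : D = ∑' j : ℤ, 2 ^ (((j + 1 : ℤ) : ℝ) * (-r)) * ω (j + 1) ^ r := by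
      rw [hDdef]
      exact ((Equiv.addRight (1 : ℤ)).tsum_eq
        (fun j : ℤ => 2 ^ ((j : ℝ) * (-r)) * ω j ^ r)).symm
    rw [hshift, ← ENNReal.tsum_mul_left]
    refine tsum_congr fun j => ?_
    rw [ENNReal.mul_rpow_of_nonneg _ _ hr0.le, ← ENNReal.rpow_mul, ← mul_assoc,
      ← two_rpow_add]
    congr 2
    push_cast
    ring
  clear_value K
  refine (qnorm_mul_le_tailSupLeft g w).trans ?_
  rw [← ENNReal.rpow_le_rpow_iff hP, qnorm_mul_rpow hp hp' hwm hΓ]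
  calc ∫⁻ x, tailSupLeft a b g μ x ^ P ∂(powMeasure w P (rIoo a b) μ)
      ≤ ∑' j : ℤ, γ j ^ P * ω (j + 1) ^ P := by
        refine (lintegral_tailSupLeft_le hp hp' hu
          (qnorm_zero_level_eq_zero hr0 (hDdef ▸ hD)) g).trans (le_of_eq ?_)
        refine tsum_congr fun j => ?_
        simp only [hω, hγ]
        push_cast
        rfl
    _ = ∑' j : ℤ, (2 ^ (j : ℝ) * γ j) ^ P * (2 ^ (-(j : ℝ)) * ω (j + 1)) ^ P := by
        refine tsum_congr fun j => ?_
        have h2 : (2 : ℝ≥0∞) ^ (j : ℝ) * 2 ^ (-(j : ℝ)) = 1 := by rw [← two_rpow_add]; simp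
        rw [← ENNReal.mul_rpow_of_nonneg _ _ hP.le, ← ENNReal.mul_rpow_of_nonneg _ _ hP.le,
          mul_mul_mul_comm, h2, one_mul]
    _ ≤ (∑' j : ℤ, ((2 ^ (j : ℝ) * γ j) ^ P) ^ (Q / P)) ^ (1 / (Q / P)) *
          (∑' j : ℤ, ((2 ^ (-(j : ℝ)) * ω (j + 1)) ^ P) ^ (r / P)) ^ (1 / (r / P)) :=
        tsum_mul_le_Lp_mul_Lq _ _ hconj
    _ = (∑' j : ℤ, 2 ^ ((j : ℝ) * Q) * γ j ^ Q) ^ (P / Q) * (2 ^ r * D) ^ (P / r) := by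
        simp only [← ENNReal.rpow_mul, mul_div_cancel₀ _ hP.ne', one_div_div]
        rw [← hωsum]
        simp only [ENNReal.mul_rpow_of_nonneg _ _ hQ.le, ← ENNReal.rpow_mul]
    _ ≤ (K * N ^ Q) ^ (P / Q) * (2 ^ r * D) ^ (P / r) := by gcongr
    _ = _ := by
        rw [ENNReal.mul_rpow_of_nonneg _ _ (by positivity),
          ENNReal.mul_rpow_of_nonneg _ _ (by positivity), ENNReal.mul_rpow_of_nonneg _ _ hP.le,
          ENNReal.mul_rpow_of_nonneg _ _ hP.le, ENNReal.mul_rpow_of_nonneg _ _ hP.le,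
          ← ENNReal.rpow_mul, ← ENNReal.rpow_mul, ← ENNReal.rpow_mul, ← ENNReal.rpow_mul,
          mul_div_cancel₀ P hQ.ne', mul_div_cancel₀ P hr0.ne', one_div_mul_eq_div,
          one_div_mul_eq_div]
        ring

/-- An increasing staircase, raised to a power, is dominated by the sum of the powers of the
tail sums. -/
theorem tsum_step_rpow_le {s : ℝ} (hs : 0 < s) (β : ℤ → ℝ≥0∞) {v : ℝ≥0∞} (hv : v ≠ 0) :
    (∑' j : ℤ, {j : ℤ | v < (2 : ℝ≥0∞) ^ (j : ℝ)}.indicator β j) ^ s ≤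
      ∑' i : ℤ, {i : ℤ | v < (2 : ℝ≥0∞) ^ (i : ℝ)}.indicator
        (fun i => (∑' j : ℤ, (Ici i).indicator β j) ^ s) i := by
  rcases eq_or_ne v ∞ with rfl | ht
  · simp [hs]
  obtain ⟨k, hk1, hk2⟩ := exists_two_rpow_le_lt hv ht
  refine le_trans ?_ (ENNReal.le_tsum (k + 1))
  rw [indicator_of_mem (show k + 1 ∈ {i : ℤ | v < (2 : ℝ≥0∞) ^ (i : ℝ)} by
    rw [mem_ofPred_eq]; push_cast; exact hk2)]
  refine ENNReal.rpow_le_rpow (ENNReal.tsum_le_tsum fun j => ?_) hs.le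
  refine indicator_le_indicator_of_subset (fun j hj => ?_) (fun _ => zero_le) j
  by_contra hjk
  have hjk' : (j : ℝ) ≤ k := by
    have : ¬ k + 1 ≤ j := hjk
    exact_mod_cast (by omega : j ≤ k)
  exact ((two_rpow_le hjk').trans hk1).not_gt hj

/-- The norm of a decreasing staircase function against the weight `u`. -/
theorem lintegral_staircase_le (hq : 0 < q) (hq' : q < ∞) {s : ℝ} (hs : 0 < s)
    (β : ℤ → ℝ≥0∞) :
    ∫⁻ y, (∑' j : ℤ, {j : ℤ | normRight q a b ν u y < (2 : ℝ≥0∞) ^ (j : ℝ)}.indicator β j) ^ s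
        ∂(powMeasure u q.toReal (rIoo a b) ν) ≤
      geomConst (q.toReal / (2 * s)) ^ s * geomConst (q.toReal / 2) *
        ∑' j : ℤ, 2 ^ ((j : ℝ) * q.toReal) * β j ^ s := by
  have hQ := ENNReal.toReal_pos hq.ne' hq'.ne
  set Q := q.toReal
  have hm : ∀ t : ℝ≥0∞, MeasurableSet {y | normRight q a b ν u y < t} := fun t =>
    measurableSet_lt (normRight_monotone q a b ν u).measurable measurable_const
  have hσ : ∀ t : ℝ≥0∞, powMeasure u Q (rIoo a b) ν {y | normRight q a b ν u y < t} ≤ t ^ Q := by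
    intro t
    rw [powMeasure_apply hq hq' u ν (hm t)]
    exact ENNReal.rpow_le_rpow (qnorm_normRight_lt_le hq a b ν u t) hQ.le
  have hnull : ∀ᵐ y ∂(powMeasure u Q (rIoo a b) ν), normRight q a b ν u y ≠ 0 := by
    rw [ae_iff]
    simp only [not_not]
    refine le_antisymm (ENNReal.le_of_forall_pos_le_add fun ε hε _ => ?_) zero_le
    rw [zero_add]
    have hε0 : (ε : ℝ≥0∞) ≠ 0 := by exact_mod_cast hε.ne'
    refine (measure_mono fun y (hy : _ = 0) => ?_).trans
      ((hσ ((ε : ℝ≥0∞) ^ (1 / Q))).trans (le_of_eq ?_))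
    · exact lt_of_eq_of_lt hy (ENNReal.rpow_pos (pos_of_ne_zero hε0) ENNReal.coe_ne_top)
    · rw [← ENNReal.rpow_mul, one_div_mul_cancel hQ.ne', ENNReal.rpow_one]
  refine le_trans ?_ (tsum_hardy_le hQ hs β)
  calc ∫⁻ y, (∑' j : ℤ,
        {j : ℤ | normRight q a b ν u y < (2 : ℝ≥0∞) ^ (j : ℝ)}.indicator β j) ^ s
        ∂(powMeasure u Q (rIoo a b) ν)
      ≤ ∫⁻ y, ∑' i : ℤ, {y | normRight q a b ν u y < (2 : ℝ≥0∞) ^ (i : ℝ)}.indicator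
          (fun _ => (∑' j : ℤ, (Ici i).indicator β j) ^ s) y
          ∂(powMeasure u Q (rIoo a b) ν) := by
        refine lintegral_mono_ae ?_
        filter_upwards [hnull] with y hy
        refine (tsum_step_rpow_le hs β hy).trans (le_of_eq (tsum_congr fun i => ?_))
        by_cases hi : normRight q a b ν u y < (2 : ℝ≥0∞) ^ (i : ℝ) <;>
          simp only [indicator, mem_ofPred_eq, hi, if_true, if_false]
    _ = ∑' i : ℤ, (∑' j : ℤ, (Ici i).indicator β j) ^ s * powMeasure u Q (rIoo a b) ν
          {y | normRight q a b ν u y < (2 : ℝ≥0∞) ^ (i : ℝ)} := by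
        rw [lintegral_tsum fun i => (measurable_const.indicator (hm _)).aemeasurable]
        refine tsum_congr fun i => ?_
        rw [lintegral_indicator (hm _), lintegral_const, Measure.restrict_apply_univ]
    _ ≤ _ := by
        refine ENNReal.tsum_le_tsum fun i => ?_
        rw [mul_comm, ENNReal.rpow_mul]
        gcongr
        exact hσ _

/-- Necessity: the test function is a decreasing staircase on the levels, with the extremal
coefficients of the Hölder inequality as steps. The discrete Hardy inequality controls its tail
suprema. -/
theorem levelSum_le_of_reverseHardy (hp : 0 < p) (hpq : p < q) (hq' : q < ∞)
    (hr : 1 / r = 1 / p.toReal - 1 / q.toReal) (hwm : Measurable w) (hum : Measurable u) {c : ℝ≥0}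
    (hc : ReverseHardy p q a b μ ν u w c) :
    (∑' j : ℤ, 2 ^ ((j : ℝ) * (-r)) *
      qnorm w p (levelSet q a ν u (2 ^ (j : ℝ)) ∩ rIoo a b) μ ^ r) ^ (1 / r) ≤
      (geomConst (q.toReal / (2 * (q.toReal / p.toReal))) ^ (q.toReal / p.toReal) *
        geomConst (q.toReal / 2)) ^ (1 / q.toReal) * c := by
  have hp' : p < ∞ := hpq.trans hq'
  have hq : 0 < q := hp.trans hpq
  have hP := ENNReal.toReal_pos hp.ne' hp'.ne
  have hQ := ENNReal.toReal_pos hq.ne' hq'.ne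
  have hPQ : p.toReal < q.toReal := ENNReal.toReal_strict_mono hq'.ne hpq
  obtain ⟨hr0, hPr, he1, he2, -⟩ := exponent_identities hP hQ hPQ hr
  set P := p.toReal
  set Q := q.toReal
  set K := geomConst (Q / (2 * (Q / P))) ^ (Q / P) * geomConst (Q / 2)
  set ω : ℤ → ℝ≥0∞ := fun j => qnorm w p (levelSet q a ν u (2 ^ (j : ℝ)) ∩ rIoo a b) μ with hω
  have hm := fun j : ℤ => measurableSet_levelSet q a ν u (2 ^ (j : ℝ))
  have hωfin : ∀ j, ω j ≠ ∞ := by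
    intro j
    have : ω j ≤ c * 2 ^ (j : ℝ) := by
      refine qnorm_le_of_ae_Iic hp ((hm j).inter (measurableSet_rIoo a b)) ?_
      filter_upwards [ae_restrict_mem ((hm j).inter (measurableSet_rIoo a b))] with x hx
      refine (qnorm_mono_set fun y hy => (⟨hy.1.2.1, EReal.coe_le_coe_iff.2 hy.2⟩ :
        y ∈ rIoc a x)).trans ((qnorm_rIoc_le_of_reverseHardy hc hx.2).trans ?_)
      gcongr
      exact le_of_lt hx.1
    exact ne_top_of_le_ne_top (ENNReal.mul_ne_top ENNReal.coe_ne_top (two_rpow_ne_top _)) this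
  rw [one_div, ENNReal.rpow_inv_le_iff hr0, ENNReal.tsum_eq_iSup_sum]
  refine iSup_le fun F => ?_
  set DF := ∑ j ∈ F, 2 ^ ((j : ℝ) * (-r)) * ω j ^ r with hDF
  have hDFtop : DF ≠ ∞ := ENNReal.sum_ne_top.2 fun j _ =>
    ENNReal.mul_ne_top (two_rpow_ne_top _) (ENNReal.rpow_ne_top_of_nonneg hr0.le (hωfin j))
  -- The extremal coefficients in the Hölder inequality, cut off to finitely many levels so that
  -- the common factor `DF` of both sides is finite and can be cancelled.
  set β : ℤ → ℝ≥0∞ := (F : Set ℤ).indicator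
    fun j => 2 ^ ((j : ℝ) * (-r)) * ω j ^ (r - P) with hβ
  have hβω : ∑' j : ℤ, β j * ω j ^ P = DF := by
    rw [hDF, tsum_eq_sum (s := F) fun j hj => by
      rw [hβ, indicator_of_notMem (by simpa using hj), zero_mul]]
    refine Finset.sum_congr rfl fun j hj => ?_
    rw [hβ, indicator_of_mem (by simpa using hj), mul_assoc,
      ← ENNReal.rpow_add_of_nonneg _ _ (by linarith) hP.le, sub_add_cancel]
  have hβQ : ∑' j : ℤ, 2 ^ ((j : ℝ) * Q) * β j ^ (Q / P) = DF := by
    have hs : 0 < Q / P := by positivity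
    rw [hDF, tsum_eq_sum (s := F) fun j hj => by
      rw [hβ, indicator_of_notMem (by simpa using hj), ENNReal.zero_rpow_of_pos hs, mul_zero]]
    refine Finset.sum_congr rfl fun j hj => ?_
    rw [hβ, indicator_of_mem (by simpa using hj), ENNReal.mul_rpow_of_nonneg _ _ hs.le,
      ← ENNReal.rpow_mul, ← ENNReal.rpow_mul, he1, mul_assoc (j : ℝ), he2, ← mul_assoc,
      ← two_rpow_add]
    congr 2
    ring
  set h : ℝ → ℝ≥0∞ := fun x => ∑' j : ℤ, (levelSet q a ν u (2 ^ (j : ℝ))).indicator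
    (fun _ => β j) x with hh
  have hhm : Measurable h := Measurable.tsum fun j => measurable_const.indicator (hm j)
  have hcancel : ∀ x : ℝ≥0∞, (x ^ (1 / P)) ^ P = x := fun x => by
    rw [← ENNReal.rpow_mul, one_div_mul_cancel hP.ne', ENNReal.rpow_one]
  have hmain := hc (fun x => h x ^ (1 / P)) (hhm.pow_const _)
  have hleft : qnorm (fun x => h x ^ (1 / P) * w x) p (rIoo a b) μ ^ P = DF := by
    simp only [mul_comm _ (w _)]
    rw [qnorm_mul_rpow hp hp' hwm (hhm.pow_const _)]
    simp only [P, hcancel, hh]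
    rw [lintegral_tsum fun j => (measurable_const.indicator (hm j)).aemeasurable, ← hβω]
    refine tsum_congr fun j => ?_
    rw [lintegral_indicator (hm j), lintegral_const, Measure.restrict_apply_univ,
      powMeasure_apply hp hp' w μ (hm j)]
  have hright : qnorm (fun x => u x * qnorm (fun x => h x ^ (1 / P)) ∞ (rIoo x b) μ) q
      (rIoo a b) ν ^ Q ≤ K * DF := by
    refine le_trans (le_of_eq
      (qnorm_mul_rpow hq hq' hum (tailSup_antitone b _ μ).measurable _ _)) ?_
    rw [← hβQ]
    refine le_trans (lintegral_mono_ae ?_)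
      (lintegral_staircase_le (a := a) (b := b) (ν := ν) (u := u) hq hq' (by positivity) β)
    filter_upwards [ae_powMeasure (ae_restrict_mem (measurableSet_rIoo a b))] with y hy
    have hQP : ∀ x : ℝ≥0∞, x ^ (Q / P) = (x ^ (1 / P)) ^ Q := fun x => by
      rw [← ENNReal.rpow_mul]; congr 1; ring
    rw [hQP]
    refine ENNReal.rpow_le_rpow (qnorm_top_le ?_) hQ.le
    filter_upwards [ae_restrict_mem (measurableSet_rIoo y b)] with x hx
    refine ENNReal.rpow_le_rpow (ENNReal.tsum_le_tsum fun j => ?_) (by positivity)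
    by_cases hxj : x ∈ levelSet q a ν u (2 ^ (j : ℝ))
    · rw [indicator_of_mem hxj, indicator_of_mem]
      change normRight q a b ν u y < 2 ^ (j : ℝ)
      refine lt_of_le_of_lt (b := qnorm u q (rIoo a x) ν) ?_ hxj
      exact iInf₂_le_of_le x (EReal.coe_lt_coe_iff.1 hx.1) (iInf_le_of_le hx.2 le_rfl)
    · rw [indicator_of_notMem hxj]
      exact zero_le
  rcases eq_or_ne DF 0 with h0 | h0
  · rw [h0]; exact zero_le
  have hfinal : DF ^ (1 / P) ≤ c * (K * DF) ^ (1 / Q) := by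
    calc DF ^ (1 / P) = qnorm (fun x => h x ^ (1 / P) * w x) p (rIoo a b) μ := by
          rw [← hleft, ← ENNReal.rpow_mul, mul_one_div_cancel hP.ne', ENNReal.rpow_one]
      _ ≤ _ := hmain
      _ ≤ _ := by
          gcongr
          rw [one_div Q, ENNReal.le_rpow_inv_iff hQ]
          exact hright
  rw [← ENNReal.rpow_inv_le_iff hr0, ← one_div, hr, ENNReal.rpow_sub _ _ h0 hDFtop]
  refine ENNReal.div_le_of_le_mul (hfinal.trans (le_of_eq ?_))
  rw [ENNReal.mul_rpow_of_nonneg _ _ (by positivity)]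
  ring

end

theorem exists_equiv_A₂ {p q : ℝ≥0∞} (hp : 0 < p) (hpq : p < q) (hq' : q < ∞) :
    ∃ C : ℝ≥0, 0 < C ∧
      ∀ (a b : EReal) (μ ν : Measure ℝ) (u w : ℝ → ℝ≥0∞), Measurable u → Measurable w →
        (∀ t ∈ rIoo a b, qnorm u q (rIoc a (t : EReal)) ν < ∞) →
        ∀ r : ℝ, 1 / r = 1 / p.toReal - 1 / q.toReal →
        ((∃ c : ℝ≥0, ReverseHardy p q a b μ ν u w c) ↔ A₂ p q r a b μ ν u w < ∞) ∧
          EquivWith C (bestConst p q a b μ ν u w) (A₂ p q r a b μ ν u w) := by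
  have hp' : p < ∞ := hpq.trans hq'
  have hq : 0 < q := hp.trans hpq
  have hP := ENNReal.toReal_pos hp.ne' hp'.ne
  have hQ := ENNReal.toReal_pos hq.ne' hq'.ne
  have hPQ : p.toReal < q.toReal := ENNReal.toReal_strict_mono hq'.ne hpq
  set r₀ : ℝ := (1 / p.toReal - 1 / q.toReal)⁻¹ with hr₀
  have hr₀' : 1 / r₀ = 1 / p.toReal - 1 / q.toReal := by rw [hr₀, one_div, inv_inv]
  obtain ⟨hr₀0, -, -, -, -⟩ := exponent_identities hP hQ hPQ hr₀'
  obtain ⟨C₁, hC₁, h₁⟩ := exists_A₂_equiv hp hq hr₀0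
  set K₁ := 2 * (2 ^ q.toReal * geomConst q.toReal * geomConst q.toReal) ^ (1 / q.toReal) with hK₁
  set K₂ := (geomConst (q.toReal / (2 * (q.toReal / p.toReal))) ^ (q.toReal / p.toReal) *
        geomConst (q.toReal / 2)) ^ (1 / q.toReal) with hK₂
  have hK₁t : K₁ ≠ ∞ := by
    have h1 := geomConst_ne_top hQ
    have h2 := two_rpow_ne_top q.toReal
    exact ENNReal.mul_ne_top (by norm_num)
      (ENNReal.rpow_ne_top_of_nonneg (by positivity) (by finiteness))
  have hK₂t : K₂ ≠ ∞ := by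
    have h1 := geomConst_ne_top (s := q.toReal / (2 * (q.toReal / p.toReal))) (by positivity)
    have h2 := geomConst_ne_top (s := q.toReal / 2) (by positivity)
    exact ENNReal.rpow_ne_top_of_nonneg (by positivity) (ENNReal.mul_ne_top
      (ENNReal.rpow_ne_top_of_nonneg (by positivity) h1) h2)
  refine ⟨C₁ * (K₁.toNNReal + K₂.toNNReal + 1), by positivity,
    fun a b μ ν u w hum hwm hu r hr => ?_⟩
  have hrr : r = r₀ := by rw [hr₀, ← hr, one_div, inv_inv]
  subst hrr
  obtain ⟨h2, h3⟩ := h₁ a b μ ν u w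
  set D := ∑' j : ℤ, 2 ^ ((j : ℝ) * (-r₀)) *
        qnorm w p (levelSet q a ν u (2 ^ (j : ℝ)) ∩ rIoo a b) μ ^ r₀ with hD
  have hcoe : ((C₁ * (K₁.toNNReal + K₂.toNNReal + 1) : ℝ≥0) : ℝ≥0∞) = C₁ * (K₁ + K₂ + 1) := by
    push_cast
    rw [ENNReal.coe_toNNReal hK₁t, ENNReal.coe_toNNReal hK₂t]
  refine bestConst_equiv (by positivity) (fun c hc => ?_) (fun c hc g _ => ?_)
  · have h4 := levelSum_le_of_reverseHardy hp hpq hq' hr hwm hum hc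
    calc A₂ p q r₀ a b μ ν u w ≤ C₁ * D ^ (1 / r₀) := h3
      _ ≤ C₁ * (K₂ * c) := by gcongr
      _ ≤ _ := by
          rw [hcoe, mul_assoc]
          gcongr
          exact le_add_right le_add_self
  · rw [hcoe] at hc
    have hA : A₂ p q r₀ a b μ ν u w ≠ ∞ := by
      intro htop
      rw [htop, ENNReal.mul_top, top_le_iff] at hc
      · exact ENNReal.coe_ne_top hc
      · exact mul_ne_zero (by exact_mod_cast hC₁.ne') (by simp)
    have hDt : D ≠ ∞ := by
      intro htop
      rw [htop, ENNReal.top_rpow_of_pos (by positivity), top_le_iff] at h2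
      exact ENNReal.mul_ne_top ENNReal.coe_ne_top hA h2
    refine (reverseHardy_of_levelSum hp hpq hq' hr hum hwm hu hD hDt g).trans ?_
    gcongr
    calc K₁ * D ^ (1 / r₀) ≤ K₁ * (C₁ * A₂ p q r₀ a b μ ν u w) := by gcongr
      _ = C₁ * K₁ * A₂ p q r₀ a b μ ν u w := by ring
      _ ≤ C₁ * (K₁ + K₂ + 1) * A₂ p q r₀ a b μ ν u w := by
          gcongr
          exact le_add_right le_self_add
      _ ≤ c := hc

/-! ### The case `q = ∞` -/

section

variable {p : ℝ≥0∞} {a b : EReal} {μ ν : Measure ℝ} {u w : ℝ → ℝ≥0∞}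

theorem A₃_eq_qnorm (hp : 0 < p) (hp' : p < ∞) :
    A₃ p.toReal a b μ ν u w =
      qnorm (fun x => w x * (qnorm u ∞ (rIoo a x) ν)⁻¹) p (rIoo a b) μ := by
  rw [qnorm_eq_lintegral hp hp', A₃]
  simp only [div_eq_mul_inv]

/-- As in `ae_le_tailSupLeft`, rational end points suffice. -/
theorem ae_le_normRight (a b : EReal) (ν : Measure ℝ) (u : ℝ → ℝ≥0∞) :
    ∀ᵐ y ∂(ν.restrict (rIoo a b)), u y ≤ normRight ∞ a b ν u y := by
  have h : ∀ t : ℚ, ∀ᵐ y ∂(ν.restrict (rIoo a b)), y ≤ (t : ℝ) →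
      u y ≤ qnorm u ∞ (rIoc a (t : ℝ)) ν := by
    intro t
    have h1 : ∀ᵐ y ∂ν, y ∈ rIoc a (t : ℝ) → u y ≤ qnorm u ∞ (rIoc a (t : ℝ)) ν :=
      (ae_restrict_iff' (measurableSet_rIoc _ _)).1 (ae_le_qnorm_top u _ ν)
    rw [ae_restrict_iff' (measurableSet_rIoo _ _)]
    filter_upwards [h1] with y hy hyI hyt
    exact hy ⟨hyI.1, EReal.coe_le_coe_iff.2 hyt⟩
  filter_upwards [ae_all_iff.2 h] with y hy
  refine le_iInf fun x => le_iInf fun hx => le_iInf fun _ => ?_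
  obtain ⟨t, ht1, ht2⟩ := exists_rat_btwn hx
  exact (hy t ht1.le).trans (qnorm_mono_set fun z hz =>
    ⟨hz.1, hz.2.trans_lt (EReal.coe_lt_coe_iff.2 ht2)⟩)

/-- The test function is `1 / ‖u‖_{∞,(a,x),ν}`; it may take the value `∞`. -/
theorem A₃_le_of_reverseHardy (hp : 0 < p) (hp' : p < ∞) {c : ℝ≥0}
    (hc : ReverseHardy p ∞ a b μ ν u w c) : A₃ p.toReal a b μ ν u w ≤ c := by
  have h := hc (fun x => (qnorm u ∞ (rIoo a x) ν)⁻¹)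
    (qnorm_rIoo_monotone u ∞ a ν).measurable.inv
  rw [A₃_eq_qnorm hp hp']
  simp only [mul_comm (w _)]
  refine h.trans (mul_le_of_le_one_right zero_le (qnorm_top_le ?_))
  filter_upwards [ae_le_normRight a b ν u] with y hy
  calc u y * qnorm (fun x => (qnorm u ∞ (rIoo a x) ν)⁻¹) ∞ (rIoo y b) μ
      ≤ normRight ∞ a b ν u y * (normRight ∞ a b ν u y)⁻¹ := by
        gcongr
        refine qnorm_top_le ?_
        filter_upwards [ae_restrict_mem (measurableSet_rIoo y b)] with x hx
        refine ENNReal.inv_le_inv.2 ?_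
        exact iInf₂_le_of_le x (EReal.coe_lt_coe_iff.1 hx.1) (iInf_le_of_le hx.2 le_rfl)
    _ ≤ 1 := ENNReal.mul_inv_le_one _

/-- The left limit of the tail supremum at `x`, times `‖u‖_{∞,(a,x),ν}`, is at most the right-hand
side norm. -/
theorem reverseHardy_of_A₃ (hp : 0 < p) (hp' : p < ∞) (hum : Measurable u) (hwm : Measurable w)
    (hu : ∀ t ∈ rIoo a b, qnorm u ∞ (rIoc a (t : EReal)) ν < ∞)
    (hA : A₃ p.toReal a b μ ν u w ≠ ∞) (g : ℝ → ℝ≥0∞) :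
    qnorm (fun x => g x * w x) p (rIoo a b) μ ≤ A₃ p.toReal a b μ ν u w *
      qnorm (fun x => u x * qnorm g ∞ (rIoo x b) μ) ∞ (rIoo a b) ν := by
  have hP := ENNReal.toReal_pos hp.ne' hp'.ne
  have hUm := (qnorm_rIoo_monotone u ∞ a ν).measurable
  set N := qnorm (fun x => u x * qnorm g ∞ (rIoo x b) μ) ∞ (rIoo a b) ν
  have hmeas : Measurable fun x : ℝ => w x * (qnorm u ∞ (rIoo a x) ν)⁻¹ := hwm.mul hUm.inv
  have hΓ : ∀ x ∈ rIoo a b, tailSupLeft a b g μ x * qnorm u ∞ (rIoo a x) ν ≤ N := by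
    intro x hx
    rw [← qnorm_const_mul (by simp) hum]
    refine le_trans (qnorm_mono_ae ?_)
      (qnorm_mono_set (fun y hy => (⟨hy.1, hy.2.trans hx.2⟩ : y ∈ rIoo a b)))
    filter_upwards [ae_restrict_mem (measurableSet_rIoo a x)] with y hy
    rw [mul_comm]
    gcongr
    exact tailSupLeft_le hy.1 (EReal.coe_lt_coe_iff.1 hy.2)
  have hfin : ∀ᵐ x ∂(μ.restrict (rIoo a b)), w x * (qnorm u ∞ (rIoo a x) ν)⁻¹ ≠ ∞ := by
    have h1 : ∫⁻ x in rIoo a b, (w x * (qnorm u ∞ (rIoo a x) ν)⁻¹) ^ p.toReal ∂μ ≠ ∞ := by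
      rw [← qnorm_rpow hp hp', ← A₃_eq_qnorm hp hp']
      exact ENNReal.rpow_ne_top_of_nonneg hP.le hA
    filter_upwards [ae_lt_top (hmeas.pow_const _) h1] with x hx htop
    rw [htop, ENNReal.top_rpow_of_pos hP] at hx
    exact hx.false
  refine (qnorm_mul_le_tailSupLeft g w).trans ?_
  rw [A₃_eq_qnorm hp hp', mul_comm, ← qnorm_const_mul hp hmeas]
  refine qnorm_mono_ae ?_
  filter_upwards [hfin, ae_restrict_mem (measurableSet_rIoo a b)] with x hx hxI
  have hUt : qnorm u ∞ (rIoo a x) ν ≠ ∞ :=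
    ((qnorm_mono_set rIoo_subset_rIoc).trans_lt (hu x hxI)).ne
  rcases eq_or_ne (qnorm u ∞ (rIoo a x) ν) 0 with h0 | h0
  · have hw : w x = 0 := by
      by_contra hw
      rw [h0, ENNReal.inv_zero, ENNReal.mul_top hw] at hx
      exact hx rfl
    rw [hw, zero_mul]
    exact zero_le
  · have h2 : tailSupLeft a b g μ x ≤ N * (qnorm u ∞ (rIoo a x) ν)⁻¹ := by
      rw [← div_eq_mul_inv, ENNReal.le_div_iff_mul_le (Or.inl h0) (Or.inl hUt)]
      exact hΓ x hxI
    calc w x * tailSupLeft a b g μ x ≤ w x * (N * (qnorm u ∞ (rIoo a x) ν)⁻¹) := by gcongr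
      _ = _ := by ring

/-- `A₃ ^ p` is the sum over the dyadic levels. -/
theorem A₃_equiv_levelSum (hp : 0 < p) (hp' : p < ∞) (hwm : Measurable w) :
    EquivWith (2 ^ p.toReal * geomConst p.toReal).toNNReal (A₃ p.toReal a b μ ν u w ^ p.toReal)
      (∑' j : ℤ, 2 ^ ((j : ℝ) * (-p.toReal)) *
        qnorm w p (levelSet ∞ a ν u (2 ^ (j : ℝ)) ∩ rIoo a b) μ ^ p.toReal) := by
  have hP := ENNReal.toReal_pos hp.ne' hp'.ne
  have hUm := (qnorm_rIoo_monotone u ∞ a ν).measurable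
  have hg := geomConst_ne_top hP
  have h2t := two_rpow_ne_top p.toReal
  rw [EquivWith, ENNReal.coe_toNNReal (by finiteness), A₃_eq_qnorm hp hp',
    qnorm_mul_rpow hp hp' hwm (h := fun x : ℝ => (qnorm u ∞ (rIoo a x) ν)⁻¹) hUm.inv]
  simp only [ENNReal.inv_rpow, ← ENNReal.rpow_neg]
  have hm := fun j : ℤ => measurableSet_levelSet ∞ a ν u (2 ^ (j : ℝ))
  have hsum : ∑' j : ℤ, 2 ^ ((j : ℝ) * (-p.toReal)) *
        qnorm w p (levelSet ∞ a ν u (2 ^ (j : ℝ)) ∩ rIoo a b) μ ^ p.toReal =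
      ∫⁻ x, ∑' j : ℤ, {j : ℤ | qnorm u ∞ (rIoo a x) ν < (2 : ℝ≥0∞) ^ (j : ℝ)}.indicator
        (fun j => (2 : ℝ≥0∞) ^ ((j : ℝ) * (-p.toReal))) j
        ∂(powMeasure w p.toReal (rIoo a b) μ) := by
    have he : ∀ (x : ℝ) (j : ℤ),
        {j : ℤ | qnorm u ∞ (rIoo a x) ν < (2 : ℝ≥0∞) ^ (j : ℝ)}.indicator
          (fun j => (2 : ℝ≥0∞) ^ ((j : ℝ) * (-p.toReal))) j =
        (levelSet ∞ a ν u (2 ^ (j : ℝ))).indicator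
          (fun _ => (2 : ℝ≥0∞) ^ ((j : ℝ) * (-p.toReal))) x := fun x j => by
      by_cases hj : qnorm u ∞ (rIoo a x) ν < (2 : ℝ≥0∞) ^ (j : ℝ) <;>
        simp only [indicator, levelSet, mem_ofPred_eq, hj, if_true, if_false]
    simp only [he]
    rw [lintegral_tsum fun j => (measurable_const.indicator (hm j)).aemeasurable]
    refine tsum_congr fun j => ?_
    rw [lintegral_indicator (hm j), lintegral_const, Measure.restrict_apply_univ,
      powMeasure_apply hp hp' w μ (hm j)]
  rw [hsum]
  constructor
  · rw [← lintegral_const_mul' _ _ (by finiteness)]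
    refine lintegral_mono fun x => (rpow_neg_le_tsum hP _).trans ?_
    gcongr
    exact le_mul_of_one_le_right zero_le (one_le_geomConst _)
  · rw [← lintegral_const_mul' _ _ (by finiteness)]
    refine lintegral_mono fun x => (tsum_indicator_two_rpow_le (s := -p.toReal) (by linarith) _
      (qnorm u ∞ (rIoo a x) ν ^ (-p.toReal)) fun j hj => ?_).trans ?_
    · rw [ENNReal.rpow_mul]
      exact rpow_neg_antitone hP (le_of_lt hj)
    · rw [abs_neg, abs_of_pos hP]
      gcongr
      exact le_mul_of_one_le_left zero_le (ENNReal.one_le_rpow (by norm_num) hP)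

end

theorem EquivWith.mono {C C' : ℝ≥0} {A B : ℝ≥0∞} (h : EquivWith C A B) (hC : C ≤ C') :
    EquivWith C' A B :=
  ⟨h.1.trans (by gcongr), h.2.trans (by gcongr)⟩

theorem exists_equiv_A₃ {p : ℝ≥0∞} (hp : 0 < p) (hp' : p < ∞) :
    ∃ C : ℝ≥0, 0 < C ∧
      ∀ (a b : EReal) (μ ν : Measure ℝ) (u w : ℝ → ℝ≥0∞), Measurable u → Measurable w →
        (∀ t ∈ rIoo a b, qnorm u ∞ (rIoc a (t : EReal)) ν < ∞) →
        ((∃ c : ℝ≥0, ReverseHardy p ∞ a b μ ν u w c) ↔ A₃ p.toReal a b μ ν u w < ∞) ∧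
          EquivWith C (bestConst p ∞ a b μ ν u w) (A₃ p.toReal a b μ ν u w) ∧
          EquivWith C (A₃ p.toReal a b μ ν u w) (A₃' p a b μ ν u w) := by
  have hP := ENNReal.toReal_pos hp.ne' hp'.ne
  have hP' : 0 ≤ 1 / p.toReal := by positivity
  obtain ⟨C₁, hC₁, h₁⟩ := exists_A₃'_equiv hp hp'
  set K : ℝ≥0 := (2 ^ p.toReal * geomConst p.toReal).toNNReal
  refine ⟨1 + C₁ * K ^ (1 / p.toReal), by positivity, fun a b μ ν u w hum hwm hu => ?_⟩
  have h := bestConst_equiv (p := p) (q := ∞) (a := a) (b := b) (μ := μ) (ν := ν) (u := u) (w := w)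
    (A := A₃ p.toReal a b μ ν u w) (C := 1) one_pos
    (fun c hc => by simpa using A₃_le_of_reverseHardy hp hp' hc)
    (fun c hc g _ => by
      rw [ENNReal.coe_one, one_mul] at hc
      exact (reverseHardy_of_A₃ hp hp' hum hwm hu
        (ne_top_of_le_ne_top ENNReal.coe_ne_top hc) g).trans (by gcongr))
  refine ⟨h.1, EquivWith.mono h.2 le_self_add,
    EquivWith.mono (C := C₁ * K ^ (1 / p.toReal)) ?_ le_add_self⟩
  obtain ⟨h2, h3⟩ := h₁ a b μ ν u w
  obtain ⟨h4, h5⟩ := A₃_equiv_levelSum (a := a) (b := b) (μ := μ) (ν := ν) (u := u) hp hp' hwm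
  set D := ∑' j : ℤ, 2 ^ ((j : ℝ) * (-p.toReal)) *
        qnorm w p (levelSet ∞ a ν u (2 ^ (j : ℝ)) ∩ rIoo a b) μ ^ p.toReal
  set A := A₃ p.toReal a b μ ν u w
  have hA : (A ^ p.toReal) ^ (1 / p.toReal) = A := by
    rw [← ENNReal.rpow_mul, mul_one_div_cancel hP.ne', ENNReal.rpow_one]
  have hroot : ∀ x y : ℝ≥0∞, x ≤ K * y →
      x ^ (1 / p.toReal) ≤ (K : ℝ≥0∞) ^ (1 / p.toReal) * y ^ (1 / p.toReal) := fun x y hxy => by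
    rw [← ENNReal.mul_rpow_of_nonneg _ _ hP']
    gcongr
  have h6 := hroot _ _ h4
  have h7 := hroot _ _ h5
  rw [hA] at h6 h7
  rw [EquivWith, ENNReal.coe_mul, ENNReal.coe_rpow_of_nonneg _ hP']
  constructor
  · calc A ≤ (K : ℝ≥0∞) ^ (1 / p.toReal) * (C₁ * A₃' p a b μ ν u w) := h6.trans (by gcongr)
      _ = _ := by ring
  · calc A₃' p a b μ ν u w ≤ C₁ * ((K : ℝ≥0∞) ^ (1 / p.toReal) * A) := h3.trans (by gcongr)
      _ = _ := by ring

end SupremalHardy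

theorem theorem3p4 (p q : ℝ≥0∞) (hp : 0 < p) (hq : 0 < q) :
    ∃ C : ℝ≥0, 0 < C ∧
      ∀ (a b : EReal) (μ ν : Measure ℝ) (u w : ℝ → ℝ≥0∞),
        a < b → Measurable u → Measurable w →
        (∀ t ∈ rIoo a b, qnorm u q (rIoc a (t : EReal)) ν < ∞) →
        (∀ᵐ x ∂(ν.restrict (rIoo a b)), u x ≠ 0) →
        (q ≤ p →
          ((∃ c : ℝ≥0, ReverseHardy p q a b μ ν u w c) ↔ A₁ p q a b μ ν u w < ∞) ∧
          EquivWith C (bestConst p q a b μ ν u w) (A₁ p q a b μ ν u w)) ∧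
        (p < q → q < ∞ → ∀ r : ℝ, 1 / r = 1 / p.toReal - 1 / q.toReal →
          ((∃ c : ℝ≥0, ReverseHardy p q a b μ ν u w c) ↔ A₂ p q r a b μ ν u w < ∞) ∧
          EquivWith C (bestConst p q a b μ ν u w) (A₂ p q r a b μ ν u w)) ∧
        (p < ∞ → q = ∞ →
          ((∃ c : ℝ≥0, ReverseHardy p q a b μ ν u w c) ↔ A₃ p.toReal a b μ ν u w < ∞) ∧
          EquivWith C (bestConst p q a b μ ν u w) (A₃ p.toReal a b μ ν u w) ∧
          EquivWith C (A₃ p.toReal a b μ ν u w) (A₃' p a b μ ν u w)) := by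
  rcases le_or_gt q p with hqp | hpq
  · obtain ⟨C, hC, h⟩ := exists_equiv_A₁ p q hq hqp
    refine ⟨C, hC, fun a b μ ν u w _ hum hwm hu _ => ⟨fun _ => h a b μ ν u w hum hwm hu,
      fun hpq => absurd hpq hqp.not_gt, fun hp' hq' => ?_⟩⟩
    exact absurd (hq' ▸ hqp) hp'.not_ge
  · rcases eq_or_ne q ∞ with rfl | hq'
    · obtain ⟨C, hC, h⟩ := exists_equiv_A₃ hp hpq
      exact ⟨C, hC, fun a b μ ν u w _ hum hwm hu _ => ⟨fun hqp => absurd hqp hpq.not_ge,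
        fun _ h' => absurd rfl h'.ne, fun _ _ => h a b μ ν u w hum hwm hu⟩⟩
    · obtain ⟨C, hC, h⟩ := exists_equiv_A₂ hp hpq hq'.lt_top
      exact ⟨C, hC, fun a b μ ν u w _ hum hwm hu _ => ⟨fun hqp => absurd hqp hpq.not_ge,
        fun _ _ => h a b μ ν u w hum hwm hu, fun _ h' => absurd h' hq'⟩⟩
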